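/- **Setting.** The Pascal graph has vertices $(x,y)\in\mathbb Z_{\ge0}^2$ and an edge from $(x,y)$ to each of $(x+1,y)$ and $(x,y+1)$; the level of $(x,y)$ is $x+y$. An *ordering* is a function $\xi$ from the vertices to $\{0,1\}$: the edge $(x-1,y)\to(x,y)$ is less than the edge $(x,y-1)\to(x,y)$ if $\xi(x,y)=1$ and greater if $\xi(x,y)=0$ ($x,y\ge1$). Let $X$ be the space of infinite directed paths from the root $(0,0)$, with the topology generated by cylinder sets. For distinct paths that eventually coincide, $\gamma<\eta$ if at the last place where they differ the edge of $\gamma$ is less than that of $\eta$. $X_{\max}$ and $X_{\min}$ are the sets of paths all of whose edges are maximal, respectively minimal (the only edge entering a boundary vertex is both). $T_\xi\gamma$ is the smallest path larger than $\gamma$; it is defined for $\gamma\notin X_{\max}$, and $T_\xi^{-1}$ is defined off $X_{\min}$. $X'_\xi$ is the orbit of $X_{\min}\cup X_{\max}$ under the (partial) powers $T_\xi^m$, $m\in\mathbb Z$. $\mathscr P_k$ is the set of paths of length $k$ from the root; the $k$-coding of $\gamma$ is the sequence $\omega_k(\gamma)$ whose $m$-th entry is the first $k$ edges of $T_\xi^m\gamma$.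 The *basic block* $B^k_\xi(x,y)$ over $\mathscr P_k$, for $x+y\ge k$, is: for $x+y=k$, the list in increasing order of all paths from the root to $(x,y)$; for $x+y>k$, the concatenation, in increasing order of the entering edges, of the basic blocks at the sources of the edges that enter $(x,y)$ (one edge if $xy=0$, two otherwise). A *$\xi$-consistent factoring scheme* for $\omega\in\mathscr P_k^{\mathbb Z}$ consists, for every $n\ge k$, of a factorization of $\omega$ into basic blocks $W_{n,i}$ ($i\in\mathbb Z$), each the block at a specified vertex of level $n$, such that each $W_{n+1,i}$, as a segment of $\omega$, is the concatenation of the one or two consecutive blocks of the level-$n$ factorization that belong to the sources of the edges entering its vertex, in the order given by $\xi$, and such that every coordinate lies, for some $n$, in a block $W_{n,i}$ whose vertex $(x,y)$ has $x,y>0$. Such a scheme *determines* at each coordinate $m$ a path: at every level $n\ge k$ it passes through the vertex $v$ of the block $W_{n,i}$ containing $m$, and if $m$ is in position $t\ge0$ of that block, its initial segment of length $n$ is the $(t+1)$-st path from the root to $v$ in increasing order. A *full $\mathbb Z$-orbit* of $\gamma$ (possibly extended) determined by $\omega$ and the scheme is a sequence of paths $(\gamma_m)_{m\in\mathbb Z}$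 with $\gamma_0=\gamma$ such that for every $m$: $\gamma_m$ is the path determined at the coordinate $m$ and its first $k$ edges are $\omega_m$; and $\gamma_{m+1}=T_\xi\gamma_m$, or $\gamma_m\in X_{\max}$ and $\gamma_{m+1}\in X_{\min}$. Its 3-coding is the sequence whose $m$-th entry is the first three edges of $\gamma_m$. A measure $\mu$ on $X$ is *adic-invariant* if $\mu(T_\xi A)=\mu(A)$ for all measurable $A\subseteq X\setminus X_{\max}$, and *ergodic* if every measurable $A$ such that $\gamma\in A\iff T_\xi\gamma\in A$ for all $\gamma\notin X_{\max}$ is null or has null complement. For $0<\alpha<1$, $\mu_\alpha$ is the probability measure on $X$ for which the measure of a cylinder set is the product of the weights of its edges, where edges $(x,y-1)\to(x,y)$ have weight $\alpha$ and edges $(x-1,y)\to(x,y)$ have weight $1-\alpha$. **Theorem.** Let $\xi$ be any ordering of the Pascal graph. 1. Let $k\ge1$, and let $\gamma\ne\gamma'$ be distinct paths with full (possibly extended) $\mathbb Z$-orbits determined by sequences $\omega,\omega'\in\mathscr P_k^{\mathbb Z}$ with $\xi$-consistent factoring schemes. Then the 3-codings of these orbits of $\gamma$ and $\gamma'$ are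 different. 2. For every $\gamma\in X\setminus X'_\xi$ all entries of the 3-coding $\omega_3(\gamma)$ are defined, and $\gamma\mapsto\omega_3(\gamma)\in\mathscr P_3^{\mathbb Z}$ is injective on $X\setminus X'_\xi$. 3. $\mu(X'_\xi)=0$ for every fully supported adic-invariant probability measure $\mu$ on $X$ that is ergodic or has no atoms, and $\mu_\alpha(X'_\xi)=0$ for each $\mu_\alpha$, $0<\alpha<1$. Hence the 3-coding is essentially faithful. -/

import Mathlib

open MeasureTheory ProbabilityTheory

namespace PascalAdic

/-! ### The Pascal graph, its orderings and its paths -/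

/-- Vertices `(x, y)` of the Pascal graph; the level of `(x, y)` is `x + y`. -/
abbrev Vertex : Type := ℕ × ℕ

/-- The edges leaving the vertex `src`: `dir = false` is the edge from `(x, y)` to `(x + 1, y)`
and `dir = true` is the edge from `(x, y)` to `(x, y + 1)`. -/
structure Edge where
  src : Vertex
  dir : Bool

/-- The range of an edge. -/
def Edge.target (e : Edge) : Vertex :=
  if e.dir then (e.src.1, e.src.2 + 1) else (e.src.1 + 1, e.src.2)

/-- An ordering of the Pascal graph is a function from the vertices to `{0, 1}`
(`false` is `0` and `true` is `1`). -/
abbrev Ordering : Type := Vertex → Bool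

/-- `e < f` for edges with the same range `w`: if `ξ w = 1`, the edge from `(x - 1, y)` to
`w = (x, y)` is less than the edge from `(x, y - 1)` to `w`; if `ξ w = 0`, it is greater. -/
def EdgeLT (ξ : Ordering) (e f : Edge) : Prop :=
  e.target = f.target ∧
    ((ξ e.target = true ∧ e.dir = false ∧ f.dir = true) ∨
      (ξ e.target = false ∧ e.dir = true ∧ f.dir = false))

def IsMinEdge (ξ : Ordering) (e : Edge) : Prop := ∀ f, ¬ EdgeLT ξ f e

def IsMaxEdge (ξ : Ordering) (e : Edge) : Prop := ∀ f, ¬ EdgeLT ξ e f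

/-- The space `X` of infinite directed paths that begin at the root `(0, 0)`: `γ n` is the
direction of the edge of `γ` from level `n` to level `n + 1` (see `edge`). The topology and the
`σ`-algebra are the product ones, generated by the cylinder sets. -/
abbrev Path : Type := ℕ → Bool

/-- The vertex of the path `γ` at level `n`. -/
def vertex (γ : Path) : ℕ → Vertex
  | 0 => (0, 0)
  | n + 1 => Edge.target ⟨vertex γ n, γ n⟩

/-- The edge of the path `γ` from level `n` to level `n + 1`. -/
def edge (γ : Path) (n : ℕ) : Edge := ⟨vertex γ n, γ n⟩

/-- The first `k` edges of the path `γ`, that is, the cylinder set of level `k` (the element of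
the partition `𝒫ₖ`) that contains `γ`. The set `𝒫ₖ` is identified with `Fin k → Bool`. -/
def initialSegment (k : ℕ) (γ : Path) : Fin k → Bool := fun i => γ i

/-- The partial order on paths: `γ < η` if there is a last place at which their edges differ,
and there the edge of `γ` is less than the edge of `η`. -/
def PathLT (ξ : Ordering) (γ η : Path) : Prop :=
  ∃ d, (∀ n, d < n → edge γ n = edge η n) ∧ EdgeLT ξ (edge γ d) (edge η d)

/-- Paths that consist entirely of maximal edges. -/
def maxPaths (ξ : Ordering) : Set Path := {γ | ∀ n, IsMaxEdge ξ (edge γ n)}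

/-- Paths that consist entirely of minimal edges. -/
def minPaths (ξ : Ordering) : Set Path := {γ | ∀ n, IsMinEdge ξ (edge γ n)}

/-! ### The adic transformation, orbits and codings -/

/-- `η` is the smallest path that is larger than `γ`. -/
def IsSuccessor (ξ : Ordering) (γ η : Path) : Prop :=
  PathLT ξ γ η ∧ ∀ ζ, PathLT ξ γ ζ → ζ = η ∨ PathLT ξ η ζ

open Classical in
/-- The adic transformation `T`, as a partial map: `T γ` is the smallest path larger than `γ`. -/
noncomputable def adic (ξ : Ordering) (γ : Path) : Option Path :=
  if h : ∃ η, IsSuccessor ξ γ η then some h.choose else none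

open Classical in
/-- The inverse of the adic transformation, as a partial map. -/
noncomputable def adicInv (ξ : Ordering) (γ : Path) : Option Path :=
  if h : ∃ η, adic ξ η = some γ then some h.choose else none

/-- The partial map `T ^ m`, for an integer `m`. -/
noncomputable def adicIter (ξ : Ordering) : ℤ → Path → Option Path
  | Int.ofNat m, γ => (fun o : Option Path => o.bind (adic ξ))^[m] (some γ)
  | Int.negSucc m, γ => (fun o : Option Path => o.bind (adicInv ξ))^[m + 1] (some γ)

/-- The set `X'`: the orbit under `T` of the set of all minimal and all maximal paths. -/
def exceptionalSet (ξ : Ordering) : Set Path :=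
  {η | ∃ γ ∈ minPaths ξ ∪ maxPaths ξ, ∃ m : ℤ, adicIter ξ m γ = some η}

/-- The `k`-coding of a path: its `m`-th entry is the first `k` edges of `T ^ m γ`, and `none`
if `T ^ m γ` is not defined. -/
noncomputable def coding (ξ : Ordering) (k : ℕ) (γ : Path) : ℤ → Option (Fin k → Bool) :=
  fun m => (adicIter ξ m γ).map (initialSegment k)

/-! ### Basic blocks and consistent factoring schemes -/

/-- All paths from the root to `(x, y)`, as lists of directions, in increasing order. -/
def pathsTo (ξ : Ordering) : ℕ → ℕ → List (List Bool)
  | 0, 0 => [[]]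
  | x + 1, 0 => (pathsTo ξ x 0).map (fun l => l ++ [false])
  | 0, y + 1 => (pathsTo ξ 0 y).map (fun l => l ++ [true])
  | x + 1, y + 1 =>
    if ξ (x + 1, y + 1) then
      (pathsTo ξ x (y + 1)).map (fun l => l ++ [false]) ++
        (pathsTo ξ (x + 1) y).map (fun l => l ++ [true])
    else
      (pathsTo ξ (x + 1) y).map (fun l => l ++ [true]) ++
        (pathsTo ξ x (y + 1)).map (fun l => l ++ [false])
  termination_by x y => x + y

/-- The basic block of the `k`-coding at `(x, y)`, for `x + y ≥ k`. Its symbols are paths of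
length `k` from the root. At level `k` it lists the paths from the root to `(x, y)` in
increasing order; at the levels `n > k` the basic blocks of level `n - 1` are concatenated
according to the ordering. -/
def basicBlock (ξ : Ordering) (k x y : ℕ) : List (List Bool) :=
  if x + y ≤ k then pathsTo ξ x y
  else
    match x, y with
    | 0, 0 => []
    | x + 1, 0 => basicBlock ξ k x 0
    | 0, y + 1 => basicBlock ξ k 0 y
    | x + 1, y + 1 =>
      if ξ (x + 1, y + 1) then basicBlock ξ k x (y + 1) ++ basicBlock ξ k (x + 1) y
      else basicBlock ξ k (x + 1) y ++ basicBlock ξ k x (y + 1)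
  termination_by x + y

/-- A consistent factoring scheme for a two-sided sequence `ω` of symbols from `𝒫ₖ`: for every
level `n ≥ k` a factorization of `ω` into basic blocks `W (n, i)` of level `n`, where `i` runs
over `ℤ`. The block `W (n, i)` is the basic block at the vertex `vert n i`, and occupies the
coordinates `cut n i ≤ m < cut n (i + 1)`. The block `W (n + 1, i)` begins where
`W (n, child n i)` begins, and is the concatenation, in the given ordering, of the basic blocks
of level `n` at the one or two vertices from which an edge enters `vert (n + 1) i`. -/
structure FactoringScheme (ξ : Ordering) (k : ℕ) (ω : ℤ → Fin k → Bool) where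
  cut : ℕ → ℤ → ℤ
  vert : ℕ → ℤ → Vertex
  child : ℕ → ℤ → ℤ
  level_eq : ∀ n, k ≤ n → ∀ i, (vert n i).1 + (vert n i).2 = n
  cut_succ : ∀ n, k ≤ n → ∀ i,
    cut n (i + 1) = cut n i + (basicBlock ξ k (vert n i).1 (vert n i).2).length
  word_eq : ∀ n, k ≤ n → ∀ i (t : ℕ),
    t < (basicBlock ξ k (vert n i).1 (vert n i).2).length →
      (basicBlock ξ k (vert n i).1 (vert n i).2)[t]? = some (List.ofFn (ω (cut n i + t)))
  cut_child : ∀ n, k ≤ n → ∀ i, cut (n + 1) i = cut n (child n i)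
  child_left : ∀ n, k ≤ n → ∀ i x, vert (n + 1) i = (x + 1, 0) →
    child n (i + 1) = child n i + 1 ∧ vert n (child n i) = (x, 0)
  child_right : ∀ n, k ≤ n → ∀ i y, vert (n + 1) i = (0, y + 1) →
    child n (i + 1) = child n i + 1 ∧ vert n (child n i) = (0, y)
  child_zero : ∀ n, k ≤ n → ∀ i x y, vert (n + 1) i = (x + 1, y + 1) →
    ξ (x + 1, y + 1) = false →
      child n (i + 1) = child n i + 2 ∧
        vert n (child n i) = (x + 1, y) ∧ vert n (child n i + 1) = (x, y + 1)
  child_one : ∀ n, k ≤ n → ∀ i x y, vert (n + 1) i = (x + 1, y + 1) →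
    ξ (x + 1, y + 1) = true →
      child n (i + 1) = child n i + 2 ∧
        vert n (child n i) = (x, y + 1) ∧ vert n (child n i + 1) = (x + 1, y)
  /-- Every coordinate lies, at some level, in the basic block of an interior vertex (and hence
  in arbitrarily long basic blocks): no coordinate remains for ever in the one-symbol basic
  blocks of the boundary vertices. -/
  interior : ∀ m : ℤ, ∃ n, k ≤ n ∧ ∃ i, cut n i ≤ m ∧ m < cut n (i + 1) ∧
    0 < (vert n i).1 ∧ 0 < (vert n i).2

/-- `γ` is the path determined by the scheme `S` at the coordinate `m`: at each level `n ≥ k`, if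
`W (n, i)` is the block of level `n` that contains the coordinate `m`, and `m` is at the
position `t` in it, then the initial segment of `γ` of length `n` is the path in position `t`
among the paths from the root to the vertex of `W (n, i)`, that is, the image under `T ^ t` of
the minimal path to that vertex. -/
def FactoringScheme.Determines {ξ : Ordering} {k : ℕ} {ω : ℤ → Fin k → Bool}
    (S : FactoringScheme ξ k ω) (m : ℤ) (γ : Path) : Prop :=
  ∀ n, k ≤ n → ∃ (i : ℤ) (t : ℕ), S.cut n i + t = m ∧
    (pathsTo ξ (S.vert n i).1 (S.vert n i).2)[t]? = some (List.ofFn (initialSegment n γ))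

/-- `O` is the full `ℤ`-orbit (under `T`, extended if necessary from a maximal path to a minimal
path) of the path `O 0` determined by the sequence `ω` and the scheme `S`. -/
structure FactoringScheme.IsFullOrbit {ξ : Ordering} {k : ℕ} {ω : ℤ → Fin k → Bool}
    (S : FactoringScheme ξ k ω) (O : ℤ → Path) : Prop where
  step : ∀ m, adic ξ (O m) = some (O (m + 1)) ∨ (O m ∈ maxPaths ξ ∧ O (m + 1) ∈ minPaths ξ)
  coding_eq : ∀ m, initialSegment k (O m) = ω m
  determined : ∀ m, S.Determines m (O m)

/-! ### Adic-invariant measures -/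

/-- The image of a set of paths under the partial map `T`. -/
def adicImage (ξ : Ordering) (A : Set Path) : Set Path :=
  {η | ∃ γ ∈ A, adic ξ γ = some η}

/-- `μ` is invariant under `T`, which is defined off the set of maximal paths. -/
def IsAdicInvariant (ξ : Ordering) (μ : Measure Path) : Prop :=
  ∀ A : Set Path, MeasurableSet A → A ⊆ (maxPaths ξ)ᶜ → μ (adicImage ξ A) = μ A

/-- Every measurable set of paths that is invariant under `T` is null or has full measure. -/
def IsAdicErgodic (ξ : Ordering) (μ : Measure Path) : Prop :=
  ∀ A : Set Path, MeasurableSet A → (∀ γ η, adic ξ γ = some η → (γ ∈ A ↔ η ∈ A)) →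
    μ A = 0 ∨ μ Aᶜ = 0

/-- The measure `μ_α`: the measure of a cylinder set is the product of the weights of the edges
that define it, where the edges from `(x, y - 1)` to `(x, y)` have weight `α` and the edges from
`(x - 1, y)` to `(x, y)` have weight `1 - α`. -/
noncomputable def bernoulliPathMeasure (α : unitInterval) : Measure Path :=
  Measure.infinitePi (fun _ : ℕ => bernoulliMeasure true false α)

end PascalAdic

/-!
# The `3`-coding of the Pascal adic is faithful for every ordering

**Codings.** The map `T` changes a path at the first edge that is not maximal (`IsStep`,
`adic_eq_some_iff`), so reversing the ordering reverses time. For a two-sided orbit, possibly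
extended from maximal to minimal paths, the coordinates `m` at which the first `n` edges of the
path are maximal are the ends of the blocks of level `n`, and the edge from level `n` on is
constant on each such block. The factorizations in the hypotheses are not needed beyond this.

Suppose that two orbits have the same `n`-coding, `n ≥ 3`, but different `(n + 1)`-codings. They
have the same blocks of level `n`, and these are grouped into blocks of level `n + 1` in two
different ways. Number the vertices of level `n` by `0, …, n` along the level; a block of level
`n + 1` is the single block `0`, the single block `n`, or a pair of neighbours `b - 1`, `b`, whose
order is fixed by the ordering. Where the groupings differ, a block is the first half of a pair in
one of them and the second half in the other (`AgreeTo.exists_ambiguous`), unless it is a single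
block in one of them. Hence the next block continues in the same direction, with the two groupings
exchanged (`Ambiguous.next`), and, going back in time, one arrives at the boundary
(`Ambiguous.exists_count_eq_zero`). From there the blocks are, up to reflection, `0, 1, 2, 3, …`,
and one of the groupings is `[0] [1 2] [3 …`. Its blocks of level `n + 1` have the numbers
`0, 2, 4`; the middle one is interior, so it has to be paired in level `n + 2` with a neighbour
whose number differs from `2` by `1`, a contradiction (`Ambiguous.count_ne_zero`). So the
`3`-coding determines all `n`-codings (`AgreeTo.eq`).

**Measures.** An adic-invariant measure gives the same mass to all cylinder sets of finite paths
with the same end (`IsAdicInvariant.isExchangeable`), and so does a Bernoulli measure. Let `f n` be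
the sum of these masses, one for each vertex of level `n`. As each interior vertex is the end of
two edges, `f n = 2 f (n + 1) - ε n`, where `ε n` is the mass of the two boundary cylinder sets.
If the two boundary paths are not atoms, `ε n` tends to `0`, and therefore so does `f n`
(`IsExchangeable.tendsto_levelMass`). The exceptional set is a countable union of sets that have,
at every large level `n`, at most one initial segment for each vertex of level `n`
(`separatedAt_minOrbit`, `exceptionalSet_subset`), so it is null. An ergodic measure of full
support has no atom at a boundary path, because this path is a `T`-invariant set by itself.
-/

namespace PascalAdic

open Filter Topology

/-! ### Edges and vertices -/

/-- The number of edges of direction `s` on any path from the root to `v`: the second coordinate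
for `true` and the first for `false`. It lets arguments treat the two directions alike. -/
def Vertex.count (s : Bool) (v : Vertex) : ℕ := if s then v.2 else v.1

/-- The ordering in which all pairs of edges with a common range are reversed. It exchanges
maximal and minimal paths, and turns `T` into its inverse. -/
def Ordering.reverse (ξ : Ordering) : Ordering := fun v => !ξ v

@[simp]
theorem Ordering.reverse_apply (ξ : Ordering) (v : Vertex) : ξ.reverse v = !ξ v := rfl

@[simp]
theorem Ordering.reverse_reverse (ξ : Ordering) : ξ.reverse.reverse = ξ := by
  funext v; simp

theorem Vertex.ext_count {v w : Vertex} (s : Bool) (h : Vertex.count s v = Vertex.count s w)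
    (h' : Vertex.count (!s) v = Vertex.count (!s) w) : v = w := by
  obtain ⟨a, b⟩ := v
  obtain ⟨c, d⟩ := w
  cases s <;> simp_all [Vertex.count]

theorem count_target (s : Bool) (e : Edge) :
    Vertex.count s e.target = Vertex.count s e.src + if e.dir = s then 1 else 0 := by
  obtain ⟨v, d⟩ := e
  cases s <;> cases d <;> simp [Vertex.count, Edge.target]

theorem Edge.src_eq_of_target_eq {e f : Edge} (h : e.target = f.target) (hd : e.dir = f.dir) :
    e.src = f.src := by
  have h1 := count_target true e
  have h2 := count_target false e
  rw [h, count_target, hd] at h1 h2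
  exact Vertex.ext_count true (by omega) (by simp only [Bool.not_true]; omega)

theorem Edge.eq_of_target_eq {e f : Edge} (h : e.target = f.target) (hd : e.dir = f.dir) :
    e = f := by
  have := Edge.src_eq_of_target_eq h hd
  cases e; cases f; simp_all

theorem edgeLT_iff {ξ : Ordering} {e f : Edge} :
    EdgeLT ξ e f ↔ e.target = f.target ∧ e.dir = (!ξ e.target) ∧ f.dir = ξ e.target := by
  unfold EdgeLT
  cases ξ e.target <;> simp

theorem edgeLT_reverse {ξ : Ordering} {e f : Edge} : EdgeLT ξ.reverse e f ↔ EdgeLT ξ f e := by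
  simp only [edgeLT_iff, Ordering.reverse_apply, Bool.not_not]
  constructor
  · rintro ⟨h, h1, h2⟩
    exact ⟨h.symm, h ▸ h2, h ▸ h1⟩
  · rintro ⟨h, h1, h2⟩
    exact ⟨h.symm, h ▸ h2, h ▸ h1⟩

theorem isMinEdge_reverse {ξ : Ordering} {e : Edge} : IsMinEdge ξ.reverse e ↔ IsMaxEdge ξ e := by
  simp only [IsMinEdge, IsMaxEdge, edgeLT_reverse]

theorem isMaxEdge_reverse {ξ : Ordering} {e : Edge} : IsMaxEdge ξ.reverse e ↔ IsMinEdge ξ e := by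
  simp only [IsMinEdge, IsMaxEdge, edgeLT_reverse]

theorem exists_partner {e : Edge} (h : 0 < Vertex.count (!e.dir) e.target) :
    ∃ f : Edge, f.target = e.target ∧ f.dir = !e.dir := by
  obtain ⟨⟨x, y⟩, d⟩ := e
  cases d
  · simp only [Vertex.count, Edge.target, Bool.not_false, if_true] at h
    refine ⟨⟨(x + 1, y - 1), true⟩, ?_, rfl⟩
    simp [Edge.target] at h ⊢
    omega
  · simp only [Vertex.count, Edge.target, Bool.not_true] at h
    refine ⟨⟨(x - 1, y + 1), false⟩, ?_, rfl⟩
    simp [Edge.target] at h ⊢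
    omega

theorem isMaxEdge_iff {ξ : Ordering} {e : Edge} :
    IsMaxEdge ξ e ↔ Vertex.count (!e.dir) e.target = 0 ∨ e.dir = ξ e.target := by
  constructor
  · intro h
    by_contra! hc
    obtain ⟨f, hf, hd⟩ := exists_partner (Nat.pos_of_ne_zero hc.1)
    have hc2 := Bool.eq_not.mpr hc.2
    exact h f (edgeLT_iff.2 ⟨hf.symm, hc2, by rw [hd, hc2, Bool.not_not]⟩)
  · rintro h f hf
    obtain ⟨h1, h2, h3⟩ := edgeLT_iff.1 hf
    rcases h with h | h
    · rw [h1, count_target, h3, h2] at h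
      simp at h
    · rw [h2] at h
      simp at h

theorem isMinEdge_iff {ξ : Ordering} {e : Edge} :
    IsMinEdge ξ e ↔ Vertex.count (!e.dir) e.target = 0 ∨ e.dir = !ξ e.target := by
  rw [← isMaxEdge_reverse, isMaxEdge_iff, Ordering.reverse_apply]

theorem isMaxEdge_or_isMinEdge (ξ : Ordering) (e : Edge) : IsMaxEdge ξ e ∨ IsMinEdge ξ e := by
  rw [isMaxEdge_iff, isMinEdge_iff]
  cases e.dir <;> cases ξ e.target <;> simp

theorem IsMinEdge.edgeLT {ξ : Ordering} {e f : Edge} (he : IsMinEdge ξ e)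
    (ht : e.target = f.target) (hd : e.dir ≠ f.dir) : EdgeLT ξ e f := by
  have hd' := Bool.eq_not.mpr hd.symm
  rcases isMinEdge_iff.1 he with h | h
  · rw [ht, count_target, hd'] at h
    simp at h
  · exact edgeLT_iff.2 ⟨ht, h, by rw [hd', h, Bool.not_not]⟩

theorem EdgeLT.right_unique {ξ : Ordering} {e f g : Edge} (h : EdgeLT ξ e f) (h' : EdgeLT ξ e g) :
    f = g := by
  rw [edgeLT_iff] at h h'
  exact Edge.eq_of_target_eq (h.1.symm.trans h'.1) (h.2.2.trans h'.2.2.symm)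

theorem EdgeLT.asymm {ξ : Ordering} {e f : Edge} (h : EdgeLT ξ e f) : ¬ EdgeLT ξ f e := by
  intro h'
  rw [edgeLT_iff] at h h'
  have := h.2.2.symm.trans h'.2.1
  rw [← h.1] at this
  simp at this

theorem EdgeLT.irrefl {ξ : Ordering} {e : Edge} : ¬ EdgeLT ξ e e := fun h => h.asymm h

theorem EdgeLT.not_isMaxEdge {ξ : Ordering} {e f : Edge} (h : EdgeLT ξ e f) :
    ¬ IsMaxEdge ξ e := fun h' => h' f h

theorem EdgeLT.not_isMinEdge {ξ : Ordering} {e f : Edge} (h : EdgeLT ξ e f) :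
    ¬ IsMinEdge ξ f := fun h' => h' e h

/-! ### Paths and their vertices -/

@[simp]
theorem edge_target (γ : Path) (n : ℕ) : (edge γ n).target = vertex γ (n + 1) := rfl

@[simp]
theorem edge_dir (γ : Path) (n : ℕ) : (edge γ n).dir = γ n := rfl

theorem count_vertex_succ (s : Bool) (γ : Path) (n : ℕ) :
    Vertex.count s (vertex γ (n + 1)) =
      Vertex.count s (vertex γ n) + if γ n = s then 1 else 0 :=
  count_target s (edge γ n)

theorem count_add_count_not (s : Bool) (γ : Path) (n : ℕ) :
    Vertex.count s (vertex γ n) + Vertex.count (!s) (vertex γ n) = n := by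
  induction n with
  | zero => cases s <;> simp [vertex, Vertex.count]
  | succ n ih =>
    rw [count_vertex_succ, count_vertex_succ]
    cases γ n <;> cases s <;> simp at ih ⊢ <;> omega

theorem vertex_congr {γ η : Path} {n : ℕ} (h : ∀ i < n, γ i = η i) : vertex γ n = vertex η n := by
  induction n with
  | zero => rfl
  | succ n ih => simp only [vertex, ih fun i hi => h i (by omega), h n (by omega)]

theorem edge_congr {γ η : Path} {n : ℕ} (hv : vertex γ n = vertex η n) (h : γ n = η n) :
    edge γ n = edge η n := by
  simp only [edge, hv, h]

theorem vertex_eq_of_eq_of_le {γ η : Path} {m n : ℕ} (hmn : m ≤ n)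
    (hv : vertex γ m = vertex η m) (h : ∀ i, m ≤ i → i < n → γ i = η i) :
    vertex γ n = vertex η n := by
  induction n, hmn using Nat.le_induction with
  | base => exact hv
  | succ n hn ih =>
    simp only [vertex, ih fun i hi hi' => h i hi (by omega), h n hn (by omega)]

/-- The path that follows `γ` up to level `n` and then has the directions of `η`. -/
def splice (n : ℕ) (γ η : Path) : Path := fun i => if i < n then γ i else η i

theorem splice_of_lt {n i : ℕ} (γ η : Path) (h : i < n) : splice n γ η i = γ i := if_pos h

theorem splice_of_le {n i : ℕ} (γ η : Path) (h : n ≤ i) : splice n γ η i = η i :=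
  if_neg (not_lt.2 h)

theorem vertex_splice {n i : ℕ} (γ η : Path) (h : i ≤ n) :
    vertex (splice n γ η) i = vertex γ i :=
  vertex_congr fun _ hj => splice_of_lt γ η (by omega)

theorem edge_splice {n i : ℕ} (γ η : Path) (h : i < n) : edge (splice n γ η) i = edge γ i :=
  edge_congr (vertex_splice γ η h.le) (splice_of_lt γ η h)

/-- The first `n` edges of `γ` are maximal. -/
def MaxTo (ξ : Ordering) (n : ℕ) (γ : Path) : Prop := ∀ i < n, IsMaxEdge ξ (edge γ i)

/-- The first `n` edges of `γ` are minimal. -/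
def MinTo (ξ : Ordering) (n : ℕ) (γ : Path) : Prop := ∀ i < n, IsMinEdge ξ (edge γ i)

theorem MaxTo.succ {ξ : Ordering} {n : ℕ} {γ : Path} (h : MaxTo ξ n γ)
    (h' : IsMaxEdge ξ (edge γ n)) : MaxTo ξ (n + 1) γ := by
  intro i hi
  rcases Nat.lt_succ_iff_lt_or_eq.1 hi with hi | rfl
  exacts [h i hi, h']

theorem maxTo_reverse {ξ : Ordering} {n : ℕ} {γ : Path} :
    MaxTo ξ.reverse n γ ↔ MinTo ξ n γ := by
  simp only [MaxTo, MinTo, isMaxEdge_reverse]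

theorem minTo_reverse {ξ : Ordering} {n : ℕ} {γ : Path} :
    MinTo ξ.reverse n γ ↔ MaxTo ξ n γ := by
  simp only [MaxTo, MinTo, isMinEdge_reverse]

theorem minPaths_reverse (ξ : Ordering) : minPaths ξ.reverse = maxPaths ξ := by
  simp only [minPaths, maxPaths, isMinEdge_reverse]

theorem maxPaths_reverse (ξ : Ordering) : maxPaths ξ.reverse = minPaths ξ := by
  simp only [minPaths, maxPaths, isMaxEdge_reverse]

theorem maxTo_congr {ξ : Ordering} {n : ℕ} {γ η : Path} (h : ∀ i < n, γ i = η i)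
    (hγ : MaxTo ξ n γ) : MaxTo ξ n η := fun i hi => by
  rw [← edge_congr (vertex_congr fun j hj => h j (by omega)) (h i hi)]
  exact hγ i hi

/-- A path that is minimal up to level `n` is least among the paths with the same vertex at
level `n`. -/
theorem MinTo.eq_or_lt {ξ : Ordering} {n : ℕ} {η ζ : Path} (hη : MinTo ξ n η)
    (hv : vertex η n = vertex ζ n) :
    (∀ i < n, η i = ζ i) ∨
      ∃ j < n, (∀ i, j < i → i < n → edge η i = edge ζ i) ∧ EdgeLT ξ (edge η j) (edge ζ j) := by
  induction n with
  | zero => exact Or.inl fun i hi => by omega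
  | succ n ih =>
    by_cases hd : η n = ζ n
    · have hv' : vertex η n = vertex ζ n :=
        Edge.src_eq_of_target_eq (e := edge η n) (f := edge ζ n) hv hd
      rcases ih (fun i hi => hη i (by omega)) hv' with h | ⟨j, hj, h, hlt⟩
      · left
        intro i hi
        rcases Nat.lt_succ_iff_lt_or_eq.1 hi with h1 | rfl
        · exact h i h1
        · exact hd
      · refine Or.inr ⟨j, by omega, fun i hi hi' => ?_, hlt⟩
        rcases Nat.lt_succ_iff_lt_or_eq.1 hi' with h1 | rfl
        · exact h i hi h1
        · exact edge_congr hv' hd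
    · exact Or.inr ⟨n, by omega, fun i hi hi' => by omega, (hη n (by omega)).edgeLT hv hd⟩

theorem MinTo.eq_of_vertex_eq {ξ : Ordering} {n : ℕ} {η ζ : Path} (hη : MinTo ξ n η)
    (hζ : MinTo ξ n ζ) (hv : vertex η n = vertex ζ n) : ∀ i < n, η i = ζ i := by
  rcases hη.eq_or_lt hv with h | ⟨j, hj, -, h⟩
  · exact h
  · exact absurd (hζ j hj) h.not_isMinEdge

theorem exists_minEdge_target (ξ : Ordering) (e : Edge) :
    ∃ f : Edge, f.target = e.target ∧ IsMinEdge ξ f := by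
  by_cases h : IsMinEdge ξ e
  · exact ⟨e, rfl, h⟩
  · simp only [IsMinEdge, not_forall, not_not] at h
    obtain ⟨f, hf⟩ := h
    exact ⟨f, hf.1, (isMaxEdge_or_isMinEdge ξ f).resolve_left hf.not_isMaxEdge⟩

theorem exists_vertex_eq {n : ℕ} {v : Vertex} (hv : v.1 + v.2 = n) : ∃ γ : Path, vertex γ n = v := by
  induction n generalizing v with
  | zero => exact ⟨fun _ => true, by simp only [vertex]; ext <;> simp <;> omega⟩
  | succ n ih =>
    obtain ⟨x, y⟩ := v
    have key : ∀ e : Edge, e.target = (x, y) → e.src.1 + e.src.2 = n →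
        ∃ γ : Path, vertex γ (n + 1) = (x, y) := by
      intro e he hs
      obtain ⟨γ, hγ⟩ := ih hs
      refine ⟨splice n γ fun _ => e.dir, ?_⟩
      simp only [vertex, vertex_splice _ _ le_rfl, splice_of_le _ _ le_rfl, hγ]
      exact he
    rcases x with _ | x
    · rcases y with _ | y
      · simp at hv
      · exact key ⟨(0, y), true⟩ rfl (by simp at hv ⊢; omega)
    · exact key ⟨(x, y), false⟩ rfl (by simp at hv ⊢; omega)

theorem level_vertex (γ : Path) (n : ℕ) : (vertex γ n).1 + (vertex γ n).2 = n := by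
  have := count_add_count_not false γ n
  simpa [Vertex.count] using this

theorem level_target (e : Edge) : e.target.1 + e.target.2 = e.src.1 + e.src.2 + 1 := by
  obtain ⟨⟨x, y⟩, d⟩ := e
  cases d <;> simp [Edge.target] <;> omega

theorem exists_minTo (ξ : Ordering) {n : ℕ} {v : Vertex} (hv : v.1 + v.2 = n) :
    ∃ γ : Path, vertex γ n = v ∧ MinTo ξ n γ := by
  induction n generalizing v with
  | zero =>
    obtain ⟨γ, hγ⟩ := exists_vertex_eq hv
    exact ⟨γ, hγ, fun i hi => by omega⟩
  | succ n ih =>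
    obtain ⟨γ, hγ⟩ := exists_vertex_eq hv
    obtain ⟨f, hft, hf⟩ := exists_minEdge_target ξ (edge γ n)
    rw [edge_target, hγ] at hft
    have hs : f.src.1 + f.src.2 = n := by
      have := level_target f
      rw [hft] at this
      omega
    obtain ⟨η, hη, hmin⟩ := ih hs
    have hlast : edge (splice n η fun _ => f.dir) n = f := by
      simp only [edge, vertex_splice _ _ le_rfl, splice_of_le _ _ le_rfl, hη]
    refine ⟨splice n η fun _ => f.dir, ?_, fun i hi => ?_⟩
    · rw [← edge_target, hlast, hft]
    · rcases Nat.lt_succ_iff_lt_or_eq.1 hi with h | rfl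
      · rw [edge_splice _ _ h]
        exact hmin i h
      · rwa [hlast]

theorem exists_maxTo (ξ : Ordering) {n : ℕ} {v : Vertex} (hv : v.1 + v.2 = n) :
    ∃ γ : Path, vertex γ n = v ∧ MaxTo ξ n γ := by
  obtain ⟨γ, h, h'⟩ := exists_minTo ξ.reverse hv
  exact ⟨γ, h, minTo_reverse.1 h'⟩

/-! ### The adic transformation -/

/-- The explicit form of `T γ = η`: the edge of `γ` from level `d` is the first one that is not
maximal; it is replaced by the next larger edge, the edges before it by the minimal ones, and the
edges after it are kept. -/
structure IsStep (ξ : Ordering) (γ η : Path) (d : ℕ) : Prop where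
  maxTo : MaxTo ξ d γ
  minTo : MinTo ξ d η
  edgeLT : EdgeLT ξ (edge γ d) (edge η d)
  tail : ∀ i, d < i → γ i = η i

theorem IsStep.reverse {ξ : Ordering} {γ η : Path} {d : ℕ} (h : IsStep ξ γ η d) :
    IsStep ξ.reverse η γ d :=
  ⟨maxTo_reverse.2 h.minTo, minTo_reverse.2 h.maxTo, edgeLT_reverse.2 h.edgeLT,
    fun i hi => (h.tail i hi).symm⟩

theorem IsStep.vertex_eq {ξ : Ordering} {γ η : Path} {d n : ℕ} (h : IsStep ξ γ η d)
    (hn : d < n) : vertex γ n = vertex η n :=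
  vertex_eq_of_eq_of_le (m := d + 1) hn h.edgeLT.1 fun i hi _ => h.tail i hi

theorem IsStep.edge_eq {ξ : Ordering} {γ η : Path} {d n : ℕ} (h : IsStep ξ γ η d)
    (hn : d < n) : edge γ n = edge η n :=
  edge_congr (h.vertex_eq hn) (h.tail n hn)

theorem PathLT.asymm {ξ : Ordering} {γ η : Path} (h : PathLT ξ γ η) : ¬ PathLT ξ η γ := by
  rintro ⟨d', ht', h'⟩
  obtain ⟨d, ht, h⟩ := h
  rcases lt_trichotomy d d' with hd | rfl | hd
  · rw [ht d' hd] at h'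
    exact h'.irrefl
  · exact h.asymm h'
  · rw [ht' d hd] at h
    exact h.irrefl

theorem IsSuccessor.unique {ξ : Ordering} {γ η η' : Path} (h : IsSuccessor ξ γ η)
    (h' : IsSuccessor ξ γ η') : η = η' := by
  rcases h.2 η' h'.1 with h1 | h1
  · exact h1.symm
  · rcases h'.2 η h.1 with h2 | h2
    · exact h2
    · exact absurd h2 h1.asymm

theorem IsStep.isSuccessor {ξ : Ordering} {γ η : Path} {d : ℕ} (h : IsStep ξ γ η d) :
    IsSuccessor ξ γ η := by
  refine ⟨⟨d, fun n hn => h.edge_eq hn, h.edgeLT⟩, ?_⟩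
  rintro ζ ⟨e, ht, hlt⟩
  rcases lt_trichotomy e d with he | rfl | he
  · exact absurd (h.maxTo e he) hlt.not_isMaxEdge
  · have hd : edge η e = edge ζ e := h.edgeLT.right_unique hlt
    have htail : ∀ n, e < n → edge η n = edge ζ n := fun n hn => (h.edge_eq hn).symm.trans (ht n hn)
    have hge : ∀ n, e ≤ n → edge η n = edge ζ n := fun n hn => by
      rcases hn.eq_or_lt with rfl | hn
      · exact hd
      · exact htail n hn
    rcases h.minTo.eq_or_lt (congrArg Edge.src hd) with h1 | ⟨j, hj, h1, h2⟩
    · left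
      funext i
      rcases lt_or_ge i e with hi | hi
      · exact (h1 i hi).symm
      · exact congrArg Edge.dir (hge i hi).symm
    · refine Or.inr ⟨j, fun n hn => ?_, h2⟩
      rcases lt_or_ge n e with hne | hne
      · exact h1 n hn hne
      · exact hge n hne
  · right
    refine ⟨e, fun n hn => (h.edge_eq (he.trans hn)).symm.trans (ht n hn), ?_⟩
    rwa [← h.edge_eq he]

theorem exists_isStep {ξ : Ordering} {γ : Path} (h : γ ∉ maxPaths ξ) : ∃ η d, IsStep ξ γ η d := by
  classical
  have hex : ∃ d, ¬ IsMaxEdge ξ (edge γ d) := by simpa [maxPaths] using h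
  set d := Nat.find hex with hd
  have hspec := Nat.find_spec hex
  rw [← hd] at hspec
  simp only [IsMaxEdge, not_forall, not_not] at hspec
  obtain ⟨f, hf⟩ := hspec
  have hs : f.src.1 + f.src.2 = d := by
    have h1 := level_target f
    rw [← hf.1, edge_target, level_vertex] at h1
    omega
  obtain ⟨η, hη, hmin⟩ := exists_minTo ξ hs
  have hlast : edge (splice d η (splice (d + 1) (fun _ => f.dir) γ)) d = f := by
    simp only [edge, vertex_splice _ _ le_rfl, splice_of_le _ _ le_rfl, hη,
      splice_of_lt _ _ (Nat.lt_succ_self d)]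
  refine ⟨splice d η (splice (d + 1) (fun _ => f.dir) γ), d, fun i hi => ?_, fun i hi => ?_, ?_,
    fun i hi => ?_⟩
  · exact not_not.1 (Nat.find_min hex hi)
  · rw [edge_splice _ _ hi]
    exact hmin i hi
  · rwa [hlast]
  · rw [splice_of_le _ _ hi.le, splice_of_le _ _ hi]

theorem IsStep.notMem_maxPaths {ξ : Ordering} {γ η : Path} {d : ℕ} (h : IsStep ξ γ η d) :
    γ ∉ maxPaths ξ := fun h' => h.edgeLT.not_isMaxEdge (h' d)

theorem IsStep.notMem_minPaths {ξ : Ordering} {γ η : Path} {d : ℕ} (h : IsStep ξ γ η d) :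
    η ∉ minPaths ξ := fun h' => h.edgeLT.not_isMinEdge (h' d)

theorem adic_eq_some_iff {ξ : Ordering} {γ η : Path} :
    adic ξ γ = some η ↔ ∃ d, IsStep ξ γ η d := by
  classical
  have key : ∀ ζ, IsSuccessor ξ γ ζ → ∃ d, IsStep ξ γ ζ d := by
    intro ζ hζ
    obtain ⟨⟨d, -, hlt⟩, -⟩ := id hζ
    obtain ⟨η', d', h'⟩ := exists_isStep (ξ := ξ) (γ := γ) fun hm => hlt.not_isMaxEdge (hm d)
    rw [hζ.unique h'.isSuccessor]
    exact ⟨d', h'⟩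
  unfold adic
  constructor
  · intro h
    split_ifs at h with hex
    obtain rfl := Option.some.inj h
    exact key _ hex.choose_spec
  · rintro ⟨d, h⟩
    have hex : ∃ η, IsSuccessor ξ γ η := ⟨η, h.isSuccessor⟩
    rw [dif_pos hex, hex.choose_spec.unique h.isSuccessor]

theorem IsStep.left_unique {ξ : Ordering} {γ γ' η : Path} {d d' : ℕ} (h : IsStep ξ γ η d)
    (h' : IsStep ξ γ' η d') : γ = γ' :=
  h.reverse.isSuccessor.unique h'.reverse.isSuccessor

theorem adicInv_eq_some_iff {ξ : Ordering} {γ η : Path} :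
    adicInv ξ η = some γ ↔ adic ξ γ = some η := by
  classical
  unfold adicInv
  constructor
  · intro h
    split_ifs at h with hex
    obtain rfl := Option.some.inj h
    exact hex.choose_spec
  · intro h
    have hex : ∃ γ, adic ξ γ = some η := ⟨γ, h⟩
    obtain ⟨d, hd⟩ := adic_eq_some_iff.1 h
    obtain ⟨d', hd'⟩ := adic_eq_some_iff.1 hex.choose_spec
    rw [dif_pos hex, hd'.left_unique hd]

theorem adic_ne_some_of_mem_maxPaths {ξ : Ordering} {γ η : Path} (h : γ ∈ maxPaths ξ) :
    adic ξ γ ≠ some η := fun h' =>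
  let ⟨_, hd⟩ := adic_eq_some_iff.1 h'
  hd.notMem_maxPaths h

theorem adic_ne_some_of_mem_minPaths {ξ : Ordering} {γ η : Path} (h : η ∈ minPaths ξ) :
    adic ξ γ ≠ some η := fun h' =>
  let ⟨_, hd⟩ := adic_eq_some_iff.1 h'
  hd.notMem_minPaths h

theorem exists_adic_eq_some {ξ : Ordering} {γ : Path} (h : γ ∉ maxPaths ξ) :
    ∃ η, adic ξ γ = some η := by
  obtain ⟨η, d, h⟩ := exists_isStep h
  exact ⟨η, adic_eq_some_iff.2 ⟨d, h⟩⟩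

theorem exists_adicInv_eq_some {ξ : Ordering} {η : Path} (h : η ∉ minPaths ξ) :
    ∃ γ, adicInv ξ η = some γ := by
  rw [← maxPaths_reverse] at h
  obtain ⟨γ, d, h⟩ := exists_isStep h
  have h' := h.reverse
  rw [Ordering.reverse_reverse] at h'
  exact ⟨γ, adicInv_eq_some_iff.2 (adic_eq_some_iff.2 ⟨d, h'⟩)⟩

theorem adicIter_zero (ξ : Ordering) (γ : Path) : adicIter ξ 0 γ = some γ := rfl

theorem adicIter_natCast_succ (ξ : Ordering) (m : ℕ) (γ : Path) :
    adicIter ξ ((m + 1 : ℕ) : ℤ) γ = (adicIter ξ m γ).bind (adic ξ) :=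
  Function.iterate_succ_apply' (fun o : Option Path => o.bind (adic ξ)) m (some γ)

theorem adicIter_neg_succ (ξ : Ordering) (m : ℕ) (γ : Path) :
    adicIter ξ (-((m + 1 : ℕ) : ℤ)) γ = (adicIter ξ (-(m : ℤ)) γ).bind (adicInv ξ) := by
  cases m with
  | zero => rfl
  | succ m =>
    exact Function.iterate_succ_apply' (fun o : Option Path => o.bind (adicInv ξ)) (m + 1) (some γ)

theorem adicIter_neg_succ' (ξ : Ordering) (m : ℕ) (γ : Path) :
    adicIter ξ (-((m + 1 : ℕ) : ℤ)) γ =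
      (fun o : Option Path => o.bind (adicInv ξ))^[m] (adicInv ξ γ) := rfl

theorem adicIter_neg_natCast (ξ : Ordering) (m : ℕ) (γ : Path) :
    adicIter ξ (-(m : ℤ)) γ = (fun o : Option Path => o.bind (adicInv ξ))^[m] (some γ) := by
  cases m <;> rfl

theorem adicIter_neg_natCast_eq_some_iff {ξ : Ordering} {m : ℕ} {γ η : Path} :
    adicIter ξ (-(m : ℤ)) η = some γ ↔ adicIter ξ m γ = some η := by
  induction m generalizing η with
  | zero =>
    simp only [Nat.cast_zero, neg_zero, adicIter_zero, Option.some.injEq]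
    exact eq_comm
  | succ m ih =>
    rw [adicIter_natCast_succ, Option.bind_eq_some_iff, adicIter_neg_succ']
    simp only [← ih, ← adicInv_eq_some_iff]
    simp only [adicIter_neg_natCast]
    rcases h : adicInv ξ η with _ | δ
    · have : ∀ k, (fun o : Option Path => o.bind (adicInv ξ))^[k] none = none := by
        intro k
        induction k with
        | zero => rfl
        | succ k ih => rw [Function.iterate_succ_apply]; exact ih
      simp [this]
    · simp

theorem adicIter_succ_of_eq_some {ξ : Ordering} {m : ℤ} {γ a b : Path}
    (ha : adicIter ξ m γ = some a) (hb : adicIter ξ (m + 1) γ = some b) : adic ξ a = some b := by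
  rcases m with m | m
  · have h := adicIter_natCast_succ ξ m γ
    rw [Nat.cast_succ] at h
    change adicIter ξ m γ = some a at ha
    change adicIter ξ (m + 1) γ = some b at hb
    rw [ha, hb] at h
    exact h.symm
  · have h := adicIter_neg_succ ξ m γ
    have e : (Int.negSucc m : ℤ) + 1 = -(m : ℤ) := by
      rw [Int.negSucc_eq]; ring
    rw [e] at hb
    rw [hb] at h
    change adicIter ξ (-((m + 1 : ℕ) : ℤ)) γ = some a at ha
    rw [ha] at h
    exact adicInv_eq_some_iff.1 h.symm

/-- All powers of `T` are defined off the exceptional set. -/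
theorem exists_adicIter_eq_some {ξ : Ordering} {γ : Path} (h : γ ∉ exceptionalSet ξ) (m : ℤ) :
    ∃ η, adicIter ξ m γ = some η := by
  obtain ⟨m, rfl | rfl⟩ := m.eq_nat_or_neg
  · induction m with
    | zero => exact ⟨γ, rfl⟩
    | succ m ih =>
      obtain ⟨η, hη⟩ := ih
      have hmax : η ∉ maxPaths ξ := fun hm =>
        h ⟨η, Or.inr hm, -m, adicIter_neg_natCast_eq_some_iff.2 hη⟩
      obtain ⟨ζ, hζ⟩ := exists_adic_eq_some hmax
      exact ⟨ζ, by rw [adicIter_natCast_succ, hη]; exact hζ⟩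
  · induction m with
    | zero => exact ⟨γ, rfl⟩
    | succ m ih =>
      obtain ⟨η, hη⟩ := ih
      have hmin : η ∉ minPaths ξ := fun hm =>
        h ⟨η, Or.inl hm, m, adicIter_neg_natCast_eq_some_iff.1 hη⟩
      obtain ⟨ζ, hζ⟩ := exists_adicInv_eq_some hmin
      exact ⟨ζ, by rw [adicIter_neg_succ, hη]; exact hζ⟩

/-! ### Extended orbits and their factorization into blocks -/

/-- `η` is the image of `γ` under `T`, possibly extended from maximal to minimal paths. -/
def StepRel (ξ : Ordering) (γ η : Path) : Prop :=
  (∃ d, IsStep ξ γ η d) ∨ (γ ∈ maxPaths ξ ∧ η ∈ minPaths ξ)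

/-- `O` is a two-sided orbit of the (possibly extended) transformation `T`. -/
def IsOrbit (ξ : Ordering) (O : ℤ → Path) : Prop := ∀ m, StepRel ξ (O m) (O (m + 1))

theorem StepRel.reverse {ξ : Ordering} {γ η : Path} (h : StepRel ξ γ η) :
    StepRel ξ.reverse η γ := by
  rcases h with ⟨d, h⟩ | ⟨h, h'⟩
  · exact Or.inl ⟨d, h.reverse⟩
  · exact Or.inr ⟨by rwa [maxPaths_reverse], by rwa [minPaths_reverse]⟩

theorem IsOrbit.reverse {ξ : Ordering} {O : ℤ → Path} (h : IsOrbit ξ O) :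
    IsOrbit ξ.reverse fun m => O (-m) := fun m => by
  have := (h (-(m + 1))).reverse
  rwa [show -(m + 1) + 1 = -m by ring] at this

/-- The passage from a block of level `n` to the next one: either the two blocks belong to
consecutive blocks of level `n + 1`, or they are the two halves of one of these. -/
theorem StepRel.of_maxTo {ξ : Ordering} {γ η : Path} {n : ℕ} (h : StepRel ξ γ η)
    (hn : MaxTo ξ n γ) :
    MinTo ξ n η ∧ ((IsMaxEdge ξ (edge γ n) ∧ IsMinEdge ξ (edge η n)) ∨
      (EdgeLT ξ (edge γ n) (edge η n) ∧ ∀ i, n < i → γ i = η i)) := by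
  rcases h with ⟨d, h⟩ | ⟨h, h'⟩
  · rcases lt_trichotomy d n with hd | rfl | hd
    · exact absurd (hn d hd) h.edgeLT.not_isMaxEdge
    · exact ⟨h.minTo, Or.inr ⟨h.edgeLT, h.tail⟩⟩
    · exact ⟨fun i hi => h.minTo i (hi.trans hd), Or.inl ⟨h.maxTo n hd, h.minTo n hd⟩⟩
  · exact ⟨fun i _ => h' i, Or.inl ⟨h n, h' n⟩⟩

theorem StepRel.of_not_maxTo {ξ : Ordering} {γ η : Path} {n : ℕ} (h : StepRel ξ γ η)
    (hn : ¬ MaxTo ξ n γ) : vertex γ n = vertex η n ∧ ∀ i, n ≤ i → γ i = η i := by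
  rcases h with ⟨d, h⟩ | ⟨h, -⟩
  · have hd : d < n := by
      by_contra hd
      exact hn fun i hi => h.maxTo i (by omega)
    exact ⟨h.vertex_eq hd, fun i hi => h.tail i (by omega)⟩
  · exact absurd (fun i _ => h i) hn

theorem StepRel.edgeLT {ξ : Ordering} {γ η : Path} {n : ℕ} (h : StepRel ξ γ η)
    (hn : MaxTo ξ n γ) (hmax : ¬ IsMaxEdge ξ (edge γ n)) :
    EdgeLT ξ (edge γ n) (edge η n) ∧ ∀ i, n < i → γ i = η i :=
  (h.of_maxTo hn).2.resolve_left fun h => hmax h.1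

/-- Within a block of level `n`, the orbit does not move beyond level `n`. -/
theorem IsOrbit.eq_of_not_maxTo {ξ : Ordering} {O : ℤ → Path} (hO : IsOrbit ξ O) {n : ℕ} {m : ℤ}
    {k : ℕ} (h : ∀ j < k, ¬ MaxTo ξ n (O (m + j))) :
    vertex (O (m + k)) n = vertex (O m) n ∧ ∀ i, n ≤ i → O (m + k) i = O m i := by
  induction k with
  | zero => simp
  | succ k ih =>
    obtain ⟨h1, h2⟩ := ih fun j hj => h j (by omega)
    obtain ⟨h3, h4⟩ := (hO (m + k)).of_not_maxTo (h k (by omega))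
    rw [show m + ((k + 1 : ℕ) : ℤ) = m + k + 1 by push_cast; ring]
    exact ⟨h3.symm.trans h1, fun i hi => (h4 i hi).symm.trans (h2 i hi)⟩

/-- Every coordinate of an orbit lies in a block of level `n` that has a last coordinate; `k` is
the distance to it. -/
theorem IsOrbit.exists_maxTo {ξ : Ordering} {O : ℤ → Path} (hO : IsOrbit ξ O) (n : ℕ) (m : ℤ) :
    ∃ k : ℕ, MaxTo ξ n (O (m + k)) ∧ ∀ j < k, ¬ MaxTo ξ n (O (m + j)) := by
  classical
  suffices h : ∃ k : ℕ, MaxTo ξ n (O (m + k)) from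
    ⟨Nat.find h, Nat.find_spec h, fun j hj => Nat.find_min h hj⟩
  induction n generalizing m with
  | zero => exact ⟨0, fun i hi => by omega⟩
  | succ n ih =>
    have least : ∀ m, ∃ k : ℕ, MaxTo ξ n (O (m + k)) ∧ edge (O (m + k)) n = edge (O m) n := by
      intro m
      obtain ⟨h1, h2⟩ := hO.eq_of_not_maxTo (m := m) fun j hj => Nat.find_min (ih m) hj
      exact ⟨Nat.find (ih m), Nat.find_spec (ih m), edge_congr h1 (h2 n le_rfl)⟩
    obtain ⟨k, hk, -⟩ := least m
    by_cases hmax : IsMaxEdge ξ (edge (O (m + k)) n)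
    · exact ⟨k, hk.succ hmax⟩
    · have hlt := ((hO (m + k)).edgeLT hk hmax).1
      obtain ⟨k', hk', he⟩ := least (m + k + 1)
      refine ⟨k + 1 + k', ?_⟩
      rw [show m + ((k + 1 + k' : ℕ) : ℤ) = m + k + 1 + k' by push_cast; ring]
      refine hk'.succ ?_
      rw [he]
      exact (isMaxEdge_or_isMinEdge ξ _).resolve_right hlt.not_isMinEdge

/-! ### Two different factorizations of one coding -/

theorem IsMinEdge.count_eq_zero {ξ : Ordering} {e : Edge} (h : IsMinEdge ξ e)
    (h' : IsMaxEdge ξ e) : Vertex.count (!e.dir) e.target = 0 := by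
  rw [isMinEdge_iff] at h
  rw [isMaxEdge_iff] at h'
  rcases h with h | h
  · exact h
  · rcases h' with h' | h'
    · exact h'
    · rw [h] at h'
      simp at h'

/-- The paths `γ` and `η` reach level `n` at the same vertex and leave it by different edges, that
of `γ` having direction `s`; the edge of `γ` is minimal and that of `η` is maximal. -/
structure Ambiguous (ξ : Ordering) (n : ℕ) (s : Bool) (γ η : Path) : Prop where
  vertex_eq : vertex γ n = vertex η n
  left : γ n = s
  right : η n = !s
  min : IsMinEdge ξ (edge γ n)
  max : IsMaxEdge ξ (edge η n)

theorem Ambiguous.reverse {ξ : Ordering} {n : ℕ} {s : Bool} {γ η : Path}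
    (h : Ambiguous ξ n s γ η) : Ambiguous ξ.reverse n (!s) η γ :=
  ⟨h.vertex_eq.symm, h.right, by rw [h.left, Bool.not_not], isMinEdge_reverse.2 h.max,
    isMaxEdge_reverse.2 h.min⟩

theorem Ambiguous.not_isMaxEdge {ξ : Ordering} {n : ℕ} {s : Bool} {γ η : Path}
    (h : Ambiguous ξ n s γ η) (hc : Vertex.count (!s) (vertex γ n) ≠ 0) :
    ¬ IsMaxEdge ξ (edge γ n) := fun hmax => by
  have := h.min.count_eq_zero hmax
  rw [edge_target, edge_dir, count_vertex_succ, h.left] at this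
  omega

theorem Ambiguous.congr {ξ : Ordering} {n : ℕ} {s : Bool} {γ η γ' η' : Path}
    (h : Ambiguous ξ n s γ η) (hγ : edge γ' n = edge γ n) (hη : edge η' n = edge η n) :
    Ambiguous ξ n s γ' η' where
  vertex_eq := (congrArg Edge.src hγ).trans (h.vertex_eq.trans (congrArg Edge.src hη).symm)
  left := (congrArg Edge.dir hγ).trans h.left
  right := (congrArg Edge.dir hη).trans h.right
  min := hγ ▸ h.min
  max := hη ▸ h.max

/-- At the end of a block of level `n` at which two orbits are ambiguous, the next block is
ambiguous again, with the roles of the two orbits exchanged, unless the edge that is minimal is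
also maximal. -/
theorem Ambiguous.next {ξ : Ordering} {n : ℕ} {s : Bool} {γ η γ' η' : Path}
    (h : Ambiguous ξ n s γ η) (hγ : StepRel ξ γ γ') (hη : StepRel ξ η η')
    (hmγ : MaxTo ξ n γ) (hmη : MaxTo ξ n η) (hv : vertex γ' n = vertex η' n)
    (hmax : ¬ IsMaxEdge ξ (edge γ n)) :
    Ambiguous ξ n s η' γ' ∧
      Vertex.count s (vertex η' n) = Vertex.count s (vertex γ n) + 1 := by
  have hlt := (hγ.edgeLT hmγ hmax).1
  have hmin : IsMinEdge ξ (edge η' n) := by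
    rcases (hη.of_maxTo hmη).2 with h1 | h1
    · exact h1.2
    · exact absurd h.max h1.1.not_isMaxEdge
  have hγ' : γ' n = !s := by
    obtain ⟨-, h1, h2⟩ := edgeLT_iff.1 hlt
    rw [edge_dir] at h1 h2
    rw [h2, ← h.left, h1, Bool.not_not]
  have hη' : η' n = s := by
    by_contra hne
    have : edge γ' n = edge η' n := edge_congr hv (hγ'.trans (Bool.eq_not.mpr hne).symm)
    exact hlt.not_isMinEdge (this ▸ hmin)
  refine ⟨⟨hv.symm, hη', hγ', hmin,
    (isMaxEdge_or_isMinEdge ξ _).resolve_right hlt.not_isMinEdge⟩, ?_⟩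
  have h1 := congrArg (Vertex.count s) hlt.1
  rw [edge_target, edge_target, count_vertex_succ, count_vertex_succ, h.left, hγ', hv] at h1
  simpa using h1.symm

/-- The first `n` edges of the two orbits are the same at each coordinate. -/
def AgreeTo (n : ℕ) (P Q : ℤ → Path) : Prop := ∀ m, ∀ i < n, P m i = Q m i

theorem AgreeTo.symm {n : ℕ} {P Q : ℤ → Path} (h : AgreeTo n P Q) : AgreeTo n Q P :=
  fun m i hi => (h m i hi).symm

theorem AgreeTo.vertex_eq {n : ℕ} {P Q : ℤ → Path} (h : AgreeTo n P Q) (m : ℤ) :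
    vertex (P m) n = vertex (Q m) n := vertex_congr (h m)

theorem AgreeTo.maxTo {ξ : Ordering} {n : ℕ} {P Q : ℤ → Path} (h : AgreeTo n P Q) {m : ℤ}
    (hm : MaxTo ξ n (P m)) : MaxTo ξ n (Q m) := maxTo_congr (h m) hm

/-- Two orbits with the same `n`-coding have the same blocks of level `n`, so one may go to the
end of the block of level `n` that contains the coordinate `m` in both. -/
theorem AgreeTo.exists_blockEnd {ξ : Ordering} {n : ℕ} {P Q : ℤ → Path} (h : AgreeTo n P Q)
    (hP : IsOrbit ξ P) (hQ : IsOrbit ξ Q) (m : ℤ) :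
    ∃ m', MaxTo ξ n (P m') ∧ MaxTo ξ n (Q m') ∧
      edge (P m') n = edge (P m) n ∧ edge (Q m') n = edge (Q m) n ∧
      (∀ i, n ≤ i → P m' i = P m i) ∧ ∀ i, n ≤ i → Q m' i = Q m i := by
  obtain ⟨k, hk, hmin⟩ := hP.exists_maxTo n m
  obtain ⟨h1, h2⟩ := hP.eq_of_not_maxTo hmin
  obtain ⟨h3, h4⟩ := hQ.eq_of_not_maxTo fun j hj hm => hmin j hj (h.symm.maxTo hm)
  exact ⟨m + k, hk, h.maxTo hk, edge_congr h1 (h2 n le_rfl), edge_congr h3 (h4 n le_rfl), h2, h4⟩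

/-- Where two factorizations of a coding into blocks of level `n + 1` differ, a block of level `n`
cannot be the first half of its block of level `n + 1` in both; by time reversal, it cannot be the
second half in both either. -/
theorem AgreeTo.isMaxEdge_or {ξ : Ordering} {n : ℕ} {P Q : ℤ → Path} (h : AgreeTo n P Q)
    (hP : IsOrbit ξ P) (hQ : IsOrbit ξ Q) {m : ℤ} (hm : P m n ≠ Q m n) :
    IsMaxEdge ξ (edge (P m) n) ∨ IsMaxEdge ξ (edge (Q m) n) := by
  by_contra! hc
  obtain ⟨m', hmP, hmQ, heP, heQ, hdP, hdQ⟩ := h.exists_blockEnd hP hQ m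
  rw [← heP, ← heQ] at hc
  rw [← hdP n le_rfl, ← hdQ n le_rfl] at hm
  -- The next block of level `n` would have to be the partner of the present one in both
  -- factorizations, on different sides.
  have hlP := edgeLT_iff.1 ((hP m').edgeLT hmP hc.1).1
  have hlQ := edgeLT_iff.1 ((hQ m').edgeLT hmQ hc.2).1
  have h1 := congrArg (Vertex.count (P m' n)) hlP.1
  have h2 := congrArg (Vertex.count (P m' n)) hlQ.1
  simp only [edge_target, count_vertex_succ, h.vertex_eq] at h1 h2
  have e1 : P (m' + 1) n = !P m' n := by
    rw [← edge_dir (P m'), hlP.2.1, Bool.not_not, ← hlP.2.2, edge_dir]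
  have e2 : Q (m' + 1) n = P m' n := by
    rw [← edge_dir (Q (m' + 1)), hlQ.2.2, Bool.eq_not.mpr hm, ← edge_dir (Q m'), hlQ.2.1,
      Bool.not_not]
  rw [e1] at h1
  rw [e2, if_neg hm.symm] at h2
  simp at h1 h2
  omega

theorem AgreeTo.reverse {n : ℕ} {P Q : ℤ → Path} (h : AgreeTo n P Q) :
    AgreeTo n (fun m => P (-m)) fun m => Q (-m) := fun m => h (-m)

theorem AgreeTo.exists_ambiguous {ξ : Ordering} {n : ℕ} {P Q : ℤ → Path} (h : AgreeTo n P Q)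
    (hP : IsOrbit ξ P) (hQ : IsOrbit ξ Q) {m : ℤ} (hm : P m n ≠ Q m n) :
    ∃ s, Ambiguous ξ n s (P m) (Q m) ∨ Ambiguous ξ n s (Q m) (P m) := by
  have h1 := h.isMaxEdge_or hP hQ hm
  have h2 := h.reverse.isMaxEdge_or hP.reverse hQ.reverse (m := -m) (by simpa using hm)
  simp only [neg_neg, isMaxEdge_reverse] at h2
  have h3 := isMaxEdge_or_isMinEdge ξ (edge (P m) n)
  have h4 := isMaxEdge_or_isMinEdge ξ (edge (Q m) n)
  have key : (IsMinEdge ξ (edge (P m) n) ∧ IsMaxEdge ξ (edge (Q m) n)) ∨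
      (IsMinEdge ξ (edge (Q m) n) ∧ IsMaxEdge ξ (edge (P m) n)) := by tauto
  rcases key with ⟨ha, hb⟩ | ⟨ha, hb⟩
  · exact ⟨P m n, Or.inl ⟨h.vertex_eq m, rfl, Bool.eq_not.mpr hm.symm, ha, hb⟩⟩
  · exact ⟨Q m n, Or.inr ⟨h.symm.vertex_eq m, rfl, Bool.eq_not.mpr hm, ha, hb⟩⟩

/-- Forward in time, an ambiguity moves one vertex further in the direction `s`. -/
theorem Ambiguous.exists_right {ξ : Ordering} {n : ℕ} {s : Bool} {P Q : ℤ → Path} {m : ℤ}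
    (ha : Ambiguous ξ n s (P m) (Q m)) (h : AgreeTo n P Q) (hP : IsOrbit ξ P) (hQ : IsOrbit ξ Q)
    (hmax : ¬ IsMaxEdge ξ (edge (P m) n)) :
    ∃ m', Ambiguous ξ n s (Q m') (P m') ∧
      Vertex.count s (vertex (Q m') n) = Vertex.count s (vertex (P m) n) + 1 := by
  obtain ⟨m', hmP, hmQ, heP, heQ, -⟩ := h.exists_blockEnd hP hQ m
  rw [← heP] at hmax
  have := (ha.congr heP heQ).next (hP m') (hQ m') hmP hmQ (h.vertex_eq _) hmax
  rw [show vertex (P m') n = vertex (P m) n from congrArg Edge.src heP] at this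
  exact ⟨m' + 1, this⟩

/-- Going back in time, an ambiguity can be followed to the boundary of the graph. -/
theorem Ambiguous.exists_count_eq_zero {ξ : Ordering} {n : ℕ} {s : Bool} {P Q : ℤ → Path} {m : ℤ}
    (ha : Ambiguous ξ n s (P m) (Q m)) (h : AgreeTo n P Q) (hP : IsOrbit ξ P) (hQ : IsOrbit ξ Q) :
    ∃ m', (Ambiguous ξ n s (P m') (Q m') ∨ Ambiguous ξ n s (Q m') (P m')) ∧
      Vertex.count s (vertex (P m') n) = 0 := by
  generalize hc : Vertex.count s (vertex (P m) n) = c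
  induction c generalizing P Q m with
  | zero => exact ⟨m, Or.inl ha, hc⟩
  | succ c ih =>
    have hr : Ambiguous ξ.reverse n (!s) ((fun m => Q (-m)) (-m)) ((fun m => P (-m)) (-m)) := by
      simpa using ha.reverse
    obtain ⟨m', ha', hc'⟩ := hr.exists_right (P := fun m => Q (-m)) (Q := fun m => P (-m))
      h.symm.reverse hQ.reverse hP.reverse
      (hr.not_isMaxEdge (by simp [← h.vertex_eq, hc]))
    have ha' := ha'.reverse
    rw [Ordering.reverse_reverse, Bool.not_not] at ha'
    simp only [neg_neg] at hc'
    have h1 := count_add_count_not s (P (-m')) n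
    have h2 := count_add_count_not s (P m) n
    rw [← h.vertex_eq m] at hc'
    obtain ⟨m'', h3, h4⟩ := ih ha' h.symm hQ hP (by rw [← h.vertex_eq]; omega)
    exact ⟨m'', h3.symm, by rwa [h.vertex_eq]⟩

/-- An ambiguity at a boundary vertex of level `n ≥ 3` is impossible: of four consecutive blocks
of level `n`, those in the middle form a block of level `n + 1` that cannot belong to a block of
level `n + 2` together with one of its neighbours. -/
theorem Ambiguous.count_ne_zero {ξ : Ordering} {n : ℕ} (hn : 3 ≤ n) {s : Bool} {P Q : ℤ → Path}
    {m : ℤ} (ha : Ambiguous ξ n s (P m) (Q m)) (h : AgreeTo n P Q) (hP : IsOrbit ξ P)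
    (hQ : IsOrbit ξ Q) : Vertex.count s (vertex (P m) n) ≠ 0 := by
  intro hc
  obtain ⟨m₀, hmP₀, hmQ₀, heP₀, heQ₀, -⟩ := h.exists_blockEnd hP hQ m
  have a₀ := ha.congr heP₀ heQ₀
  have c₀ : Vertex.count s (vertex (P m₀) n) = 0 := by
    rw [show vertex (P m₀) n = vertex (P m) n from congrArg Edge.src heP₀, hc]
  have s₀ := count_add_count_not s (P m₀) n
  obtain ⟨b₁, c₁⟩ := a₀.next (hP m₀) (hQ m₀) hmP₀ hmQ₀ (h.vertex_eq _)
    (a₀.not_isMaxEdge (by omega))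
  obtain ⟨m₁, hmQ₁, hmP₁, heQ₁, heP₁, hdQ₁, -⟩ := h.symm.exists_blockEnd hQ hP (m₀ + 1)
  have a₁ := b₁.congr heQ₁ heP₁
  have c₁' : Vertex.count s (vertex (Q m₁) n) = 1 := by
    rw [show vertex (Q m₁) n = vertex (Q (m₀ + 1)) n from congrArg Edge.src heQ₁, c₁, c₀]
  have s₁ := count_add_count_not s (Q m₁) n
  have hmax₁ := a₁.not_isMaxEdge (by omega)
  obtain ⟨b₂, c₂⟩ := a₁.next (hQ m₁) (hP m₁) hmQ₁ hmP₁ (h.symm.vertex_eq _) hmax₁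
  obtain ⟨m₂, hmP₂, hmQ₂, heP₂, heQ₂, -, hdQ₂⟩ := h.exists_blockEnd hP hQ (m₁ + 1)
  have a₂ := b₂.congr heP₂ heQ₂
  have c₂' : Vertex.count s (vertex (P m₂) n) = 2 := by
    rw [show vertex (P m₂) n = vertex (P (m₁ + 1)) n from congrArg Edge.src heP₂, c₂, c₁']
  have s₂ := count_add_count_not s (P m₂) n
  obtain ⟨b₃, c₃⟩ := a₂.next (hP m₂) (hQ m₂) hmP₂ hmQ₂ (h.vertex_eq _)
    (a₂.not_isMaxEdge (by omega))
  -- The blocks of level `n + 1` of `Q` at `m₀`, `m₀ + 1`, `m₂`, `m₂ + 1`.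
  have d₀ : Vertex.count s (vertex (Q m₀) (n + 1)) = 0 := by
    rw [count_vertex_succ, a₀.right, ← h.vertex_eq, c₀]; simp
  have d₁ : Vertex.count s (vertex (Q (m₀ + 1)) (n + 1)) = 2 := by
    rw [count_vertex_succ, b₁.left, c₁, c₀]; simp
  have d₂ : Vertex.count s (vertex (Q m₂) (n + 1)) = 2 := by
    rw [count_vertex_succ, a₂.right, ← h.vertex_eq, c₂']; simp
  have d₃ : Vertex.count s (vertex (Q (m₂ + 1)) (n + 1)) = 4 := by
    rw [count_vertex_succ, b₃.left, c₃, c₂']; simp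
  have hmin : IsMinEdge ξ (edge (Q (m₀ + 1)) (n + 1)) := by
    rcases ((hQ m₀).of_maxTo (hmQ₀.succ a₀.max)).2 with h1 | h1
    · exact h1.2
    · have := congrArg (Vertex.count s) h1.1.1
      rw [edge_target, edge_target, count_vertex_succ, d₀, count_vertex_succ, d₁] at this
      split_ifs at this <;> omega
  have hmax : IsMaxEdge ξ (edge (Q m₂) (n + 1)) := by
    rcases ((hQ m₂).of_maxTo (hmQ₂.succ a₂.max)).2 with h1 | h1
    · exact h1.1
    · have := congrArg (Vertex.count s) h1.1.1
      rw [edge_target, edge_target, count_vertex_succ, d₂, count_vertex_succ, d₃] at this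
      split_ifs at this <;> omega
  obtain ⟨hlt, htail⟩ := (hQ m₁).edgeLT hmQ₁ hmax₁
  have hedge : edge (Q m₂) (n + 1) = edge (Q (m₀ + 1)) (n + 1) := by
    apply edge_congr
    · rw [← edge_target, ← edge_target, heQ₂, ← hlt.1, heQ₁]
    · rw [hdQ₂ _ (by omega), ← htail _ (by omega), hdQ₁ _ (by omega)]
  rw [hedge] at hmax
  have hz := hmin.count_eq_zero hmax
  have s₃ := count_add_count_not s (Q (m₀ + 1)) (n + 1)
  rw [edge_target, edge_dir] at hz
  rcases Bool.eq_or_eq_not (Q (m₀ + 1) (n + 1)) s with e | e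
  · rw [e, count_vertex_succ] at hz
    omega
  · rw [e, Bool.not_not, count_vertex_succ] at hz
    omega

/-- From level `3` on, the coding by the first `n` edges determines that by the first `n + 1`. -/
theorem AgreeTo.succ {ξ : Ordering} {n : ℕ} (hn : 3 ≤ n) {P Q : ℤ → Path} (h : AgreeTo n P Q)
    (hP : IsOrbit ξ P) (hQ : IsOrbit ξ Q) : AgreeTo (n + 1) P Q := by
  intro m i hi
  rcases Nat.lt_succ_iff_lt_or_eq.1 hi with hi | rfl
  · exact h m i hi
  by_contra hm
  have key : ∀ {P Q : ℤ → Path} {s}, AgreeTo i P Q → IsOrbit ξ P → IsOrbit ξ Q →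
      Ambiguous ξ i s (P m) (Q m) → False := by
    intro P Q s h hP hQ ha
    obtain ⟨m', ha' | ha', hc⟩ := ha.exists_count_eq_zero h hP hQ
    · exact ha'.count_ne_zero hn h hP hQ hc
    · exact ha'.count_ne_zero hn h.symm hQ hP (by rwa [← h.vertex_eq])
  obtain ⟨s, ha | ha⟩ := h.exists_ambiguous hP hQ hm
  · exact key h hP hQ ha
  · exact key h.symm hQ hP ha

theorem AgreeTo.eq {ξ : Ordering} {P Q : ℤ → Path} (h : AgreeTo 3 P Q)
    (hP : IsOrbit ξ P) (hQ : IsOrbit ξ Q) : P = Q := by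
  have : ∀ n, 3 ≤ n → AgreeTo n P Q := fun n hn => by
    induction n, hn using Nat.le_induction with
    | base => exact h
    | succ n hn ih => exact ih.succ hn hP hQ
  funext m i
  exact this (i + 3) (by omega) m i (by omega)

theorem agreeTo_of_initialSegment_eq {n : ℕ} {P Q : ℤ → Path}
    (h : ∀ m, initialSegment n (P m) = initialSegment n (Q m)) : AgreeTo n P Q :=
  fun m i hi => congrFun (h m) ⟨i, hi⟩

theorem FactoringScheme.IsFullOrbit.isOrbit {ξ : Ordering} {k : ℕ} {ω : ℤ → Fin k → Bool}
    {S : FactoringScheme ξ k ω} {O : ℤ → Path} (h : S.IsFullOrbit O) : IsOrbit ξ O := fun m =>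
  (h.step m).imp_left adic_eq_some_iff.1

/-- The `3`-coding is injective off the exceptional set. -/
theorem injOn_coding (ξ : Ordering) : Set.InjOn (coding ξ 3) (exceptionalSet ξ)ᶜ := by
  have orbit : ∀ γ ∈ (exceptionalSet ξ)ᶜ, ∃ O : ℤ → Path, IsOrbit ξ O ∧
      (∀ m, adicIter ξ m γ = some (O m)) ∧ O 0 = γ := by
    intro γ hγ
    choose O hO using exists_adicIter_eq_some hγ
    exact ⟨O, fun m => Or.inl (adic_eq_some_iff.1 (adicIter_succ_of_eq_some (hO m) (hO (m + 1)))),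
      hO, (Option.some.inj ((adicIter_zero ξ γ).symm.trans (hO 0))).symm⟩
  intro γ hγ γ' hγ' h
  obtain ⟨O, hO, hc, h0⟩ := orbit γ hγ
  obtain ⟨O', hO', hc', h0'⟩ := orbit γ' hγ'
  have hagree : AgreeTo 3 O O' := agreeTo_of_initialSegment_eq fun m => by
    have := congrFun h m
    simp only [coding, hc, hc', Option.map_some, Option.some.injEq] at this
    exact this
  rw [← h0, ← h0', hagree.eq hO hO']

/-! ### Exchangeable measures -/

/-- The cylinder set of the paths with the same first `n` edges as `γ`. -/
def cyl (n : ℕ) (γ : Path) : Set Path := Set.pi (Finset.range n : Set ℕ) fun i => {γ i}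

theorem mem_cyl {n : ℕ} {γ ζ : Path} : ζ ∈ cyl n γ ↔ ∀ i < n, ζ i = γ i := by
  simp [cyl]

theorem cyl_congr {n : ℕ} {γ η : Path} (h : ∀ i < n, γ i = η i) : cyl n γ = cyl n η := by
  ext ζ
  simp only [mem_cyl]
  exact forall₂_congr fun i hi => by rw [h i hi]

theorem measurableSet_cyl (n : ℕ) (γ : Path) : MeasurableSet (cyl n γ) :=
  MeasurableSet.pi (Finset.countable_toSet _) fun i _ => measurableSet_singleton (γ i)

theorem iInter_cyl (γ : Path) : ⋂ n, cyl n γ = {γ} := by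
  ext ζ
  simp only [Set.mem_iInter, mem_cyl, Set.mem_singleton_iff]
  exact ⟨fun h => funext fun i => h (i + 1) i (by omega), fun h _ _ _ => by rw [h]⟩

theorem antitone_cyl (γ : Path) : Antitone fun n => cyl n γ := fun _ _ hmn _ hζ =>
  mem_cyl.2 fun i hi => mem_cyl.1 hζ i (hi.trans_le hmn)

/-- Cylinder sets of finite paths with the same end have the same measure. -/
def IsExchangeable (μ : Measure Path) : Prop :=
  ∀ (n : ℕ) (γ η : Path), vertex γ n = vertex η n → μ (cyl n γ) = μ (cyl n η)

/-- The path that begins with `j` edges of direction `true` and goes on with direction `false`. -/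
def cornerPath (j : ℕ) : Path := fun i => decide (i < j)

theorem count_cornerPath {j n : ℕ} (h : j ≤ n) :
    Vertex.count true (vertex (cornerPath j) n) = j := by
  have : ∀ n, Vertex.count true (vertex (cornerPath j) n) = min j n := by
    intro n
    induction n with
    | zero => simp [vertex, Vertex.count]
    | succ n ih =>
      rw [count_vertex_succ, ih]
      simp only [cornerPath, decide_eq_true_eq]
      split_ifs <;> omega
  rw [this, min_eq_left h]

/-- The measure of the cylinder set of a finite path from the root to the vertex `(n - j, j)`. -/
noncomputable def cylMass (μ : Measure Path) (n j : ℕ) : ℝ := μ.real (cyl n (cornerPath j))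

theorem vertex_eq_of_count_eq {γ η : Path} {n : ℕ}
    (h : Vertex.count true (vertex γ n) = Vertex.count true (vertex η n)) :
    vertex γ n = vertex η n := by
  have h1 := count_add_count_not true γ n
  have h2 := count_add_count_not true η n
  exact Vertex.ext_count true h (by omega)

theorem IsExchangeable.real_cyl {μ : Measure Path} (hμ : IsExchangeable μ) {n j : ℕ} {γ : Path}
    (h : Vertex.count true (vertex γ n) = j) : μ.real (cyl n γ) = cylMass μ n j := by
  have hj : j ≤ n := by
    have := count_add_count_not true γ n
    omega
  rw [cylMass, measureReal_def, measureReal_def,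
    hμ n γ (cornerPath j) (vertex_eq_of_count_eq (h.trans (count_cornerPath hj).symm))]

theorem IsExchangeable.cylMass_eq_add {μ : Measure Path} [IsProbabilityMeasure μ]
    (hμ : IsExchangeable μ) {n j : ℕ} (hj : j ≤ n) :
    cylMass μ n j = cylMass μ (n + 1) j + cylMass μ (n + 1) (j + 1) := by
  set e : Bool → Path := fun b => splice n (cornerPath j) fun _ => b
  have hv : ∀ b, vertex (e b) n = vertex (cornerPath j) n := fun b => vertex_splice _ _ le_rfl
  have hlast : ∀ b, e b n = b := fun b => splice_of_le _ _ le_rfl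
  have hlt : ∀ b, ∀ i < n, e b i = cornerPath j i := fun b i hi => splice_of_lt _ _ hi
  have hunion : cyl n (cornerPath j) = cyl (n + 1) (e false) ∪ cyl (n + 1) (e true) := by
    ext ζ
    simp only [Set.mem_union, mem_cyl, Nat.lt_succ_iff_lt_or_eq, or_imp, forall_and,
      forall_eq, hlast]
    constructor
    · intro h
      cases hb : ζ n
      · exact Or.inl ⟨fun i hi => by rw [h i hi, hlt _ i hi], rfl⟩
      · exact Or.inr ⟨fun i hi => by rw [h i hi, hlt _ i hi], rfl⟩
    · rintro (⟨h, -⟩ | ⟨h, -⟩) i hi <;> rw [h i hi, hlt _ i hi]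
  have hdisj : Disjoint (cyl (n + 1) (e false)) (cyl (n + 1) (e true)) := by
    rw [Set.disjoint_left]
    intro ζ h h'
    have h1 := mem_cyl.1 h n (by omega)
    have h2 := mem_cyl.1 h' n (by omega)
    rw [hlast] at h1 h2
    simp [h1] at h2
  rw [cylMass, hunion, measureReal_union hdisj (measurableSet_cyl _ _),
    hμ.real_cyl (j := j), hμ.real_cyl (j := j + 1)]
  · rw [count_vertex_succ, hlast, hv, count_cornerPath hj]; simp
  · rw [count_vertex_succ, hlast, hv, count_cornerPath hj]; simp

/-- The sum over the vertices of level `n` of the measure of one cylinder set for each. -/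
noncomputable def levelMass (μ : Measure Path) (n : ℕ) : ℝ :=
  ∑ j ∈ Finset.range (n + 1), cylMass μ n j

/-- Each interior vertex of level `n + 1` is the end of two edges, and each of the two boundary
vertices of one. -/
theorem IsExchangeable.levelMass_eq {μ : Measure Path} [IsProbabilityMeasure μ]
    (hμ : IsExchangeable μ) (n : ℕ) :
    levelMass μ n =
      2 * levelMass μ (n + 1) - (cylMass μ (n + 1) 0 + cylMass μ (n + 1) (n + 1)) := by
  have h : levelMass μ n = ∑ j ∈ Finset.range (n + 1), cylMass μ (n + 1) j +
      ∑ j ∈ Finset.range (n + 1), cylMass μ (n + 1) (j + 1) := by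
    rw [levelMass, ← Finset.sum_add_distrib]
    exact Finset.sum_congr rfl fun j hj =>
      hμ.cylMass_eq_add (Nat.lt_succ_iff.1 (Finset.mem_range.1 hj))
  have h1 : levelMass μ (n + 1) = _ := Finset.sum_range_succ (cylMass μ (n + 1)) (n + 1)
  have h2 : levelMass μ (n + 1) = _ := Finset.sum_range_succ' (cylMass μ (n + 1)) (n + 1)
  linarith

theorem cylMass_nonneg (μ : Measure Path) (n j : ℕ) : 0 ≤ cylMass μ n j := measureReal_nonneg

theorem add_cylMass_le_levelMass (μ : Measure Path) (n : ℕ) :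
    cylMass μ (n + 1) 0 + cylMass μ (n + 1) (n + 1) ≤ levelMass μ (n + 1) := by
  rw [levelMass, Finset.sum_range_succ', Finset.sum_range_succ]
  have := Finset.sum_nonneg fun j (_ : j ∈ Finset.range n) => cylMass_nonneg μ (n + 1) (j + 1)
  linarith

theorem tendsto_real_cyl {μ : Measure Path} [IsProbabilityMeasure μ] {γ : Path}
    (h : μ {γ} = 0) : Tendsto (fun n => μ.real (cyl n γ)) atTop (𝓝 0) := by
  have := tendsto_measure_iInter_atTop (μ := μ)
    (fun n => (measurableSet_cyl n γ).nullMeasurableSet) (antitone_cyl γ)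
    ⟨0, measure_ne_top μ _⟩
  rw [iInter_cyl, h] at this
  exact (ENNReal.tendsto_toReal ENNReal.zero_ne_top).comp this

/-- If the two paths along the boundary of the graph are not atoms, then the measures of one
cylinder set for each vertex of level `n` add up to a quantity that tends to `0`. -/
theorem IsExchangeable.tendsto_levelMass {μ : Measure Path} [IsProbabilityMeasure μ]
    (hμ : IsExchangeable μ) (h : ∀ b : Bool, μ {fun _ => b} = 0) :
    Tendsto (levelMass μ) atTop (𝓝 0) := by
  have hanti : Antitone (levelMass μ) := antitone_nat_of_succ_le fun n => by
    have h1 := hμ.levelMass_eq n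
    have h2 := add_cylMass_le_levelMass μ n
    linarith
  have hbdd : BddBelow (Set.range (levelMass μ)) :=
    ⟨0, by rintro _ ⟨n, rfl⟩; exact Finset.sum_nonneg fun j _ => cylMass_nonneg μ n j⟩
  have hlim := tendsto_atTop_ciInf hanti hbdd
  have hz : ∀ n, cylMass μ n 0 = μ.real (cyl n fun _ => false) := fun n => by
    rw [cylMass]
    congr 1
  have ht : ∀ n, cylMass μ n n = μ.real (cyl n fun _ => true) := fun n => by
    rw [cylMass]
    congr 1
    exact cyl_congr fun i hi => by simp [cornerPath, hi]
  have heps : Tendsto (fun n => cylMass μ n 0 + cylMass μ n n) atTop (𝓝 0) := by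
    simp only [hz, ht]
    simpa using (tendsto_real_cyl (h false)).add (tendsto_real_cyl (h true))
  have hrec := ((hlim.comp (tendsto_add_atTop_nat 1)).const_mul 2).sub
    (heps.comp (tendsto_add_atTop_nat 1))
  have heq := tendsto_nhds_unique hlim (hrec.congr fun n => (hμ.levelMass_eq n).symm)
  rw [show (⨅ n, levelMass μ n) = 0 by linarith] at hlim
  exact hlim

/-- The points of `C` are determined up to level `n` by their vertices at level `n`. -/
def SeparatedAt (n : ℕ) (C : Set Path) : Prop :=
  ∀ γ ∈ C, ∀ η ∈ C, vertex γ n = vertex η n → ∀ i < n, γ i = η i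

/-- A set separated at level `n` is covered by one cylinder set for each vertex of level `n`. -/
theorem SeparatedAt.measureReal_le {μ : Measure Path} [IsProbabilityMeasure μ]
    (hμ : IsExchangeable μ) {n : ℕ} {C : Set Path} (hC : SeparatedAt n C) :
    μ.real C ≤ levelMass μ n := by
  have hsub : C ⊆ ⋃ j ∈ Finset.range (n + 1), {γ ∈ C | Vertex.count true (vertex γ n) = j} := by
    intro γ hγ
    have := count_add_count_not true γ n
    simp only [Set.mem_iUnion, Finset.mem_range]
    exact ⟨Vertex.count true (vertex γ n), by omega, hγ, rfl⟩
  refine (measureReal_mono hsub (measure_ne_top μ _)).trans ((measureReal_biUnion_finset_le _ _).trans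
    (Finset.sum_le_sum fun j _ => ?_))
  rcases Set.eq_empty_or_nonempty {γ ∈ C | Vertex.count true (vertex γ n) = j} with he | ⟨γ, hγ⟩
  · rw [he, measureReal_empty]
    exact cylMass_nonneg μ n j
  · rw [← hμ.real_cyl hγ.2]
    refine measureReal_mono fun ζ hζ => mem_cyl.2 (hC ζ hζ.1 γ hγ.1 ?_)
    exact vertex_eq_of_count_eq (hζ.2.trans hγ.2.symm)

/-! ### The exceptional set is null -/

/-- The `m`-th images of the minimal paths under `T`, for as long as the first `m` applications
of `T` change nothing beyond level `N`. -/
def minOrbit (ξ : Ordering) (N : ℕ) : ℕ → Set Path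
  | 0 => minPaths ξ
  | m + 1 => {η | ∃ γ ∈ minOrbit ξ N m, ∃ d < N, IsStep ξ γ η d}

theorem minOrbit_mono (ξ : Ordering) {N N' : ℕ} (h : N ≤ N') (m : ℕ) :
    minOrbit ξ N m ⊆ minOrbit ξ N' m := by
  induction m with
  | zero => exact subset_rfl
  | succ m ih =>
    rintro η ⟨γ, hγ, d, hd, hs⟩
    exact ⟨γ, ih hγ, d, hd.trans_le h, hs⟩

/-- A step that changes nothing beyond level `n` is determined by the first `n` edges. -/
theorem IsStep.congr {ξ : Ordering} {γ γ' η η' : Path} {d e n : ℕ} (h : IsStep ξ γ γ' d)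
    (h' : IsStep ξ η η' e) (hd : d < n) (he : e < n) (heq : ∀ i < n, γ i = η i) :
    ∀ i < n, γ' i = η' i := by
  have hedge : ∀ i < n, edge γ i = edge η i := fun i hi =>
    edge_congr (vertex_congr fun j hj => heq j (hj.trans hi)) (heq i hi)
  obtain rfl : d = e := by
    rcases lt_trichotomy d e with hde | hde | hde
    · exact absurd (hedge d hd ▸ h'.maxTo d hde) h.edgeLT.not_isMaxEdge
    · exact hde
    · exact absurd ((hedge e he).symm ▸ h.maxTo e hde) h'.edgeLT.not_isMaxEdge
  have hlast : edge γ' d = edge η' d := h.edgeLT.right_unique ((hedge d hd).symm ▸ h'.edgeLT)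
  intro i hi
  rcases lt_trichotomy i d with hid | rfl | hid
  · exact h.minTo.eq_of_vertex_eq h'.minTo (congrArg Edge.src hlast) i hid
  · exact congrArg Edge.dir hlast
  · rw [← h.tail i hid, ← h'.tail i hid, heq i hi]

/-- The vertex at level `n ≥ N` of `T ^ m γ` is that of `γ`, which determines the minimal path `γ`
up to level `n`, and hence `T ^ m γ`. -/
theorem separatedAt_minOrbit (ξ : Ordering) {N n : ℕ} (h : N ≤ n) (m : ℕ) :
    SeparatedAt n (minOrbit ξ N m) := by
  induction m with
  | zero =>
    intro γ hγ η hη hv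
    exact MinTo.eq_of_vertex_eq (fun i _ => hγ i) (fun i _ => hη i) hv
  | succ m ih =>
    rintro γ' ⟨γ, hγ, d, hd, hs⟩ η' ⟨η, hη, e, he, hs'⟩ hv
    refine hs.congr hs' (hd.trans_le h) (he.trans_le h) (ih γ hγ η hη ?_)
    rw [hs.vertex_eq (hd.trans_le h), hs'.vertex_eq (he.trans_le h), hv]

theorem exists_mem_minOrbit {ξ : Ordering} {m : ℕ} {γ η : Path} (hγ : γ ∈ minPaths ξ)
    (h : adicIter ξ m γ = some η) : ∃ N, η ∈ minOrbit ξ N m := by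
  induction m generalizing η with
  | zero =>
    obtain rfl := Option.some.inj h
    exact ⟨0, hγ⟩
  | succ m ih =>
    rw [adicIter_natCast_succ, Option.bind_eq_some_iff] at h
    obtain ⟨δ, hδ, h⟩ := h
    obtain ⟨d, hd⟩ := adic_eq_some_iff.1 h
    obtain ⟨N, hN⟩ := ih hδ
    exact ⟨max N (d + 1), δ, minOrbit_mono ξ (le_max_left _ _) m hN, d,
      lt_of_lt_of_le (Nat.lt_succ_self d) (le_max_right _ _), hd⟩

theorem exists_mem_minOrbit_reverse {ξ : Ordering} {m : ℕ} {γ η : Path} (hγ : γ ∈ maxPaths ξ)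
    (h : adicIter ξ (-(m : ℤ)) γ = some η) : ∃ N, η ∈ minOrbit ξ.reverse N m := by
  induction m generalizing η with
  | zero =>
    obtain rfl := Option.some.inj h
    exact ⟨0, by rwa [minOrbit, minPaths_reverse]⟩
  | succ m ih =>
    rw [adicIter_neg_succ, Option.bind_eq_some_iff] at h
    obtain ⟨δ, hδ, h⟩ := h
    obtain ⟨d, hd⟩ := adic_eq_some_iff.1 (adicInv_eq_some_iff.1 h)
    obtain ⟨N, hN⟩ := ih hδ
    exact ⟨max N (d + 1), δ, minOrbit_mono _ (le_max_left _ _) m hN, d,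
      lt_of_lt_of_le (Nat.lt_succ_self d) (le_max_right _ _), hd.reverse⟩

/-- Images of minimal paths under negative powers of `T`, and of maximal paths under positive ones,
do not exist, and the reversed ordering turns preimages of maximal paths into images of minimal
ones. -/
theorem exceptionalSet_subset (ξ : Ordering) :
    exceptionalSet ξ ⊆ ⋃ (m : ℕ) (N : ℕ), minOrbit ξ N m ∪ minOrbit ξ.reverse N m := by
  rintro η ⟨γ, hγ, m, hm⟩
  suffices h : ∃ m N, η ∈ minOrbit ξ N m ∨ η ∈ minOrbit ξ.reverse N m by simpa using h
  obtain ⟨m, rfl | rfl⟩ := m.eq_nat_or_neg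
  · rcases hγ with hγ | hγ
    · obtain ⟨N, hN⟩ := exists_mem_minOrbit hγ hm
      exact ⟨m, N, Or.inl hN⟩
    · cases m with
      | zero =>
        obtain ⟨N, hN⟩ := exists_mem_minOrbit_reverse (m := 0) hγ hm
        exact ⟨0, N, Or.inr hN⟩
      | succ m =>
        -- `T` is not defined at a maximal path.
        rw [← adicIter_neg_natCast_eq_some_iff, adicIter_neg_succ, Option.bind_eq_some_iff] at hm
        obtain ⟨δ, -, h⟩ := hm
        exact absurd (adicInv_eq_some_iff.1 h) (adic_ne_some_of_mem_maxPaths hγ)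
  · rcases hγ with hγ | hγ
    · cases m with
      | zero =>
        obtain ⟨N, hN⟩ := exists_mem_minOrbit (m := 0) hγ hm
        exact ⟨0, N, Or.inl hN⟩
      | succ m =>
        -- The inverse of `T` is not defined at a minimal path.
        rw [adicIter_neg_natCast_eq_some_iff, adicIter_natCast_succ,
          Option.bind_eq_some_iff] at hm
        obtain ⟨δ, -, h⟩ := hm
        exact absurd h (adic_ne_some_of_mem_minPaths hγ)
    · obtain ⟨N, hN⟩ := exists_mem_minOrbit_reverse hγ hm
      exact ⟨m, N, Or.inr hN⟩

theorem IsExchangeable.measure_exceptionalSet {μ : Measure Path} [IsProbabilityMeasure μ]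
    (hμ : IsExchangeable μ) (h : ∀ b : Bool, μ {fun _ => b} = 0) (ξ : Ordering) :
    μ (exceptionalSet ξ) = 0 := by
  have null : ∀ (ξ : Ordering) N m, μ (minOrbit ξ N m) = 0 := by
    intro ξ N m
    have hle : μ.real (minOrbit ξ N m) ≤ 0 :=
      ge_of_tendsto (hμ.tendsto_levelMass h) (eventually_atTop.2
        ⟨N, fun n hn => (separatedAt_minOrbit ξ hn m).measureReal_le hμ⟩)
    exact (measureReal_eq_zero_iff).1 (le_antisymm hle measureReal_nonneg)
  refine measure_mono_null (exceptionalSet_subset ξ) ?_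
  simp only [measure_iUnion_null_iff, measure_union_null_iff]
  exact fun m N => ⟨null ξ N m, null ξ.reverse N m⟩

/-! ### Adic-invariant measures and Bernoulli measures are exchangeable -/

theorem IsStep.splice {ξ : Ordering} {γ η : Path} {d N : ℕ} (h : IsStep ξ γ η d) (hd : d < N)
    (ζ : Path) : IsStep ξ (splice N γ ζ) (splice N η ζ) d where
  maxTo i hi := by rw [edge_splice _ _ (hi.trans hd)]; exact h.maxTo i hi
  minTo i hi := by rw [edge_splice _ _ (hi.trans hd)]; exact h.minTo i hi
  edgeLT := by rw [edge_splice _ _ hd, edge_splice _ _ hd]; exact h.edgeLT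
  tail i hi := by
    rcases lt_or_ge i N with h1 | h1
    · rw [splice_of_lt _ _ h1, splice_of_lt _ _ h1, h.tail i hi]
    · rw [splice_of_le _ _ h1, splice_of_le _ _ h1]

theorem splice_eq_self {N : ℕ} {γ ζ : Path} (h : ζ ∈ cyl N γ) : splice N γ ζ = ζ := by
  funext i
  rcases lt_or_ge i N with h1 | h1
  · rw [splice_of_lt _ _ h1, mem_cyl.1 h i h1]
  · rw [splice_of_le _ _ h1]

theorem splice_mem_cyl (N : ℕ) (γ ζ : Path) : splice N γ ζ ∈ cyl N γ :=
  mem_cyl.2 fun _ hi => splice_of_lt γ ζ hi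

theorem IsStep.adicImage_cyl {ξ : Ordering} {γ η : Path} {d N : ℕ} (h : IsStep ξ γ η d)
    (hd : d < N) : adicImage ξ (cyl N γ) = cyl N η := by
  ext ζ
  constructor
  · rintro ⟨δ, hδ, hs⟩
    have h1 := adic_eq_some_iff.2 ⟨d, h.splice hd δ⟩
    rw [splice_eq_self hδ, hs] at h1
    rw [Option.some.inj h1]
    exact splice_mem_cyl N η δ
  · intro hζ
    refine ⟨_, splice_mem_cyl N γ ζ, adic_eq_some_iff.2 ⟨d, ?_⟩⟩
    have h1 := h.splice hd ζ
    rwa [splice_eq_self hζ] at h1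

theorem IsAdicInvariant.measure_cyl_eq {ξ : Ordering} {μ : Measure Path}
    (hμ : IsAdicInvariant ξ μ) {γ η : Path} {d N : ℕ} (h : IsStep ξ γ η d) (hd : d < N) :
    μ (cyl N γ) = μ (cyl N η) := by
  rw [← h.adicImage_cyl hd]
  refine (hμ _ (measurableSet_cyl N γ) fun ζ hζ => ?_).symm
  rw [← splice_eq_self hζ]
  exact (h.splice hd ζ).notMem_maxPaths

/-- By induction on the level `n` from which on the two paths coincide: if they enter their common
vertex of level `n + 1` by different edges, then their initial segments may be replaced by the
greatest, respectively the least, one with the same end at level `n`, and `T` maps one to the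
other. -/
theorem IsAdicInvariant.measure_cyl_eq_of_tail {ξ : Ordering} {μ : Measure Path}
    (hμ : IsAdicInvariant ξ μ) {n N : ℕ} (hN : n ≤ N) {γ η : Path}
    (hv : vertex γ n = vertex η n) (ht : ∀ i, n ≤ i → γ i = η i) :
    μ (cyl N γ) = μ (cyl N η) := by
  induction n generalizing γ η with
  | zero => rw [show γ = η from funext fun i => ht i (Nat.zero_le i)]
  | succ n ih =>
    have key : ∀ {γ η : Path}, (∀ i, n + 1 ≤ i → γ i = η i) → EdgeLT ξ (edge γ n) (edge η n) →
        μ (cyl N γ) = μ (cyl N η) := by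
      intro γ η ht hlt
      obtain ⟨a, ha, hmax⟩ := exists_maxTo ξ (level_vertex γ n)
      obtain ⟨b, hb, hmin⟩ := exists_minTo ξ (level_vertex η n)
      have hva : vertex (splice n a γ) n = vertex γ n := (vertex_splice _ _ le_rfl).trans ha
      have hvb : vertex (splice n b η) n = vertex η n := (vertex_splice _ _ le_rfl).trans hb
      have hs : IsStep ξ (splice n a γ) (splice n b η) n :=
        { maxTo := fun i hi => by rw [edge_splice _ _ hi]; exact hmax i hi
          minTo := fun i hi => by rw [edge_splice _ _ hi]; exact hmin i hi
          edgeLT := by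
            rwa [edge_congr hva (splice_of_le _ _ le_rfl),
              edge_congr hvb (splice_of_le _ _ le_rfl)]
          tail := fun i hi => by
            rw [splice_of_le _ _ hi.le, splice_of_le _ _ hi.le, ht i hi] }
      rw [← ih (by omega) hva fun i hi => splice_of_le _ _ hi, hμ.measure_cyl_eq hs (by omega),
        ih (by omega) hvb fun i hi => splice_of_le _ _ hi]
    by_cases hd : γ n = η n
    · refine ih (by omega) (Edge.src_eq_of_target_eq (e := edge γ n) (f := edge η n) hv hd) ?_
      intro i hi
      rcases hi.eq_or_lt with rfl | hi
      exacts [hd, ht i hi]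
    · rcases isMaxEdge_or_isMinEdge ξ (edge γ n) with h | h
      · rw [← isMinEdge_reverse] at h
        exact (key (fun i hi => (ht i hi).symm) (edgeLT_reverse.1 (h.edgeLT hv hd))).symm
      · exact key ht (h.edgeLT hv hd)

theorem IsAdicInvariant.isExchangeable {ξ : Ordering} {μ : Measure Path}
    (hμ : IsAdicInvariant ξ μ) : IsExchangeable μ := by
  intro n γ η hv
  rw [cyl_congr fun i hi => (splice_of_lt (n := n) η γ hi).symm]
  exact hμ.measure_cyl_eq_of_tail le_rfl (hv.trans (vertex_splice _ _ le_rfl).symm)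
    fun i hi => (splice_of_le _ _ hi).symm

theorem count_vertex_const (b : Bool) (n : ℕ) :
    Vertex.count (!b) (vertex (fun _ => b) n) = 0 := by
  induction n with
  | zero => cases b <;> rfl
  | succ n ih => rw [count_vertex_succ, ih]; simp

theorem const_mem_maxPaths (ξ : Ordering) (b : Bool) : (fun _ => b) ∈ maxPaths ξ := fun n =>
  isMaxEdge_iff.2 (Or.inl (count_vertex_const b (n + 1)))

theorem const_mem_minPaths (ξ : Ordering) (b : Bool) : (fun _ => b) ∈ minPaths ξ := fun n =>
  isMinEdge_iff.2 (Or.inl (count_vertex_const b (n + 1)))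

/-- A path along the boundary is a `T`-orbit of its own, so it has measure `0` or `1`, and `1` is
excluded by full support. -/
theorem IsAdicErgodic.measure_const {ξ : Ordering} {μ : Measure Path} [μ.IsOpenPosMeasure]
    (hμ : IsAdicErgodic ξ μ) (b : Bool) : μ {fun _ => b} = 0 := by
  refine (hμ {fun _ => b} (measurableSet_singleton _) fun γ η h => ?_).resolve_right fun h => ?_
  · constructor
    · rintro rfl
      exact absurd h (adic_ne_some_of_mem_maxPaths (const_mem_maxPaths ξ b))
    · rintro rfl
      exact absurd h (adic_ne_some_of_mem_minPaths (const_mem_minPaths ξ b))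
  · have hopen : IsOpen ({fun _ => b} : Set Path)ᶜ := isOpen_compl_singleton
    refine hopen.measure_ne_zero μ ⟨fun _ => !b, fun h' => ?_⟩ h
    simpa using congrFun (Set.mem_singleton_iff.1 h') 0

theorem bernoulliPathMeasure_cyl (α : unitInterval) (n : ℕ) (γ : Path) :
    bernoulliPathMeasure α (cyl n γ) =
      bernoulliMeasure true false α {true} ^ Vertex.count true (vertex γ n) *
        bernoulliMeasure true false α {false} ^ Vertex.count false (vertex γ n) := by
  rw [bernoulliPathMeasure, cyl,
    Measure.infinitePi_pi _ fun i _ => measurableSet_singleton (γ i)]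
  induction n with
  | zero => simp [vertex, Vertex.count]
  | succ n ih =>
    rw [Finset.prod_range_succ, ih, count_vertex_succ, count_vertex_succ]
    cases γ n <;> simp <;> ring

theorem isExchangeable_bernoulliPathMeasure (α : unitInterval) :
    IsExchangeable (bernoulliPathMeasure α) := fun n γ η h => by
  rw [bernoulliPathMeasure_cyl, bernoulliPathMeasure_cyl, h]

theorem bernoulliMeasure_singleton_lt_one {α : unitInterval} (h0 : 0 < α) (h1 : α < 1)
    (b : Bool) : bernoulliMeasure true false α {b} < 1 := by
  classical
  rw [bernoulliMeasure_apply _ (measurableSet_singleton b)]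
  cases b
  · simp [← NNReal.coe_lt_one, unitInterval.coe_toNNReal]
    exact h0
  · simp [← NNReal.coe_lt_one, unitInterval.coe_toNNReal]
    exact h1

theorem bernoulliPathMeasure_const {α : unitInterval} (h0 : 0 < α) (h1 : α < 1) (b : Bool) :
    bernoulliPathMeasure α {fun _ => b} = 0 := by
  have hle : ∀ n, bernoulliPathMeasure α {fun _ => b} ≤
      bernoulliMeasure true false α {b} ^ n := fun n => by
    have hc := count_vertex_const b n
    have hn := count_add_count_not b (fun _ => b) n
    rw [hc, add_zero] at hn
    refine (measure_mono (Set.singleton_subset_iff.2 (mem_cyl.2 fun _ _ => rfl))).trans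
      (bernoulliPathMeasure_cyl α n fun _ => b).le |>.trans ?_
    cases b
    · rw [hn, show Vertex.count true _ = 0 from hc, pow_zero, one_mul]
    · rw [hn, show Vertex.count false _ = 0 from hc, pow_zero, mul_one]
  have hlim := ENNReal.tendsto_pow_atTop_nhds_zero_of_lt_one
    (bernoulliMeasure_singleton_lt_one h0 h1 b)
  exact le_antisymm (ge_of_tendsto' hlim hle) bot_le

end PascalAdic

open PascalAdic in
theorem theorem3p4 (ξ : PascalAdic.Ordering) :
    (∀ (k : ℕ), 1 ≤ k → ∀ (ω ω' : ℤ → Fin k → Bool)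
      (S : FactoringScheme ξ k ω) (S' : FactoringScheme ξ k ω') (O O' : ℤ → PascalAdic.Path),
      S.IsFullOrbit O → S'.IsFullOrbit O' → O 0 ≠ O' 0 →
        (fun m => initialSegment 3 (O m)) ≠ (fun m => initialSegment 3 (O' m))) ∧
    (∀ γ ∈ (exceptionalSet ξ)ᶜ, ∀ m : ℤ, (coding ξ 3 γ m).isSome) ∧
    Set.InjOn (coding ξ 3) (exceptionalSet ξ)ᶜ ∧
    (∀ (μ : MeasureTheory.Measure PascalAdic.Path) [MeasureTheory.IsProbabilityMeasure μ]
      [μ.IsOpenPosMeasure],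
      IsAdicInvariant ξ μ → (IsAdicErgodic ξ μ ∨ ∀ γ : PascalAdic.Path, μ {γ} = 0) →
        μ (exceptionalSet ξ) = 0) ∧
    (∀ α : unitInterval, 0 < α → α < 1 →
      bernoulliPathMeasure α (exceptionalSet ξ) = 0) := by
  refine ⟨?_, ?_, injOn_coding ξ, ?_, ?_⟩
  · intro k _ ω ω' S S' O O' hO hO' hne heq
    have h := agreeTo_of_initialSegment_eq (congrFun heq)
    exact hne (congrFun (h.eq hO.isOrbit hO'.isOrbit) 0)
  · intro γ hγ m
    obtain ⟨η, hη⟩ := exists_adicIter_eq_some hγ m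
    simp [coding, hη]
  · intro μ _ _ hμ h
    refine hμ.isExchangeable.measure_exceptionalSet (fun b => ?_) ξ
    rcases h with h | h
    · exact h.measure_const b
    · exact h _
  · intro α h0 h1
    have : IsProbabilityMeasure (bernoulliPathMeasure α) := by
      unfold bernoulliPathMeasure
      infer_instance
    exact (isExchangeable_bernoulliPathMeasure α).measure_exceptionalSet
      (bernoulliPathMeasure_const h0 h1) ξ
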